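/- Let $1<\alpha<2$, $0<d<1-\frac1\alpha$ and $1<p<\alpha$. Let $\{L_\alpha(t)\}_{t\in\mathbb R}$ be a symmetric $\alpha$-stable process with Lebesgue control measure on a probability space $(\Omega,\mathcal F,\mathbb P)$: $L_\alpha(0)=0$ a.s., the increments over successive intervals are independent, and $\mathbb E\,e^{i\theta(L_\alpha(t)-L_\alpha(s))}=e^{-(t-s)|\theta|^\alpha}$ for $s\le t$ and $\theta\in\mathbb R$. Let $g:\mathbb R\to\mathbb R$ be measurable with $g(t)=0$ for $t<0$ and $|g(t)|\le Ce^{-ct}$ for all $t$, for some constants $C,c>0$. Write $$(I_+^dg)(x)=\frac1{\Gamma(d)}\int_{-\infty}^x g(t)(x-t)^{d-1}\,dt,\qquad (I_-^dg)(x)=\frac1{\Gamma(d)}\int_x^{\infty} g(t)(t-x)^{d-1}\,dt .$$ *Integrals.* A simple function is $\phi=\sum_{i=1}^{n-1}a_i\mathbf 1_{(t_i,t_{i+1}]}$ with $t_1<\dots<t_n$ and $a_i\in\mathbb R$; for a process $X$, $\int\phi\,dX=\sum_i a_i(X(t_{i+1})-X(t_i))$. For $f\in L^\alpha(\mathbb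 R)$, $\int f\,dL_\alpha$ is the limit in probability of $\int\phi_k\,dL_\alpha$ for any simple $\phi_k\to f$ in $L^\alpha(\mathbb R)$. The linear fractional stable motion is $$M_d(t)=\frac1{\Gamma(d+1)}\int_{\mathbb R}\big[(t-x)_+^d-(-x)_+^d\big]\,dL_\alpha(x),\qquad t\in\mathbb R .$$ For $h\in L^1(\mathbb R)\cap L^\alpha(\mathbb R)$ put $\|h\|_{\alpha,p}=\mathbb E[|L_\alpha(1)|^p]^{1/p}\,\|I_-^dh\|_{L^\alpha(\mathbb R)}$; the integral $\int h\,dM_d$ is the limit in $L^p(\Omega,\mathbb P)$ of $\int\phi_k\,dM_d$ for any simple $\phi_k$ with $\|\phi_k-h\|_{\alpha,p}\to0$. Integrals over $(-\infty,t]$ are integrals of the integrand multiplied by $\mathbf 1_{(-\infty,t]}$. **Theorem.** The process $M_d$ and the FIMA stable process $$Y_d(t)=\int_{-\infty}^t (I_+^dg)(t-x)\,dL_\alpha(x),\qquad t\in\mathbb R,$$ are well defined (approximating simple functions exist and the limits exist and do not depend on their choice), and for every $t\in\mathbb R$ the integral on the right below is well defined in the same sense and $$Y_d(t)=\int_{-\infty}^t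 g(t-x)\,dM_d(x)\qquad\text{almost surely.}$$ -/

import Mathlib

open MeasureTheory ProbabilityTheory Filter Topology
open scoped ENNReal

noncomputable section

/-- A symmetric `α`-stable process on the line with Lebesgue control measure (standard symmetric
`α`-stable Lévy motion): `L 0 = 0` a.s., the increments over successive intervals are independent,
and `L t - L s` has the law `S_α((t - s)^(1/α), 0, 0)` for `s ≤ t`, i.e. the characteristic function
`θ ↦ exp (-(t - s) |θ| ^ α)`. -/
structure IsSymmStableMotion {Ω : Type*} [MeasurableSpace Ω] (P : Measure Ω) (α : ℝ)
    (L : ℝ → Ω → ℝ) : Prop where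
  measurable : ∀ t, Measurable (L t)
  zero : ∀ᵐ ω ∂P, L 0 ω = 0
  indep : HasIndepIncrements L P
  charFun_increment : ∀ s t : ℝ, s ≤ t → ∀ θ : ℝ,
    charFun (P.map (fun ω => L t ω - L s ω)) θ = (Real.exp (-((t - s) * |θ| ^ α)) : ℝ)

/-- A simple function `∑ i, a i • 1_{(t i, t (i+1)]}` with knots `t 0 < t 1 < ⋯ < t n`. -/
structure StepFun where
  n : ℕ
  t : Fin (n + 1) → ℝ
  a : Fin n → ℝ
  strictMono : StrictMono t

namespace StepFun

/-- The simple function as a function on the line. -/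
def toFun (φ : StepFun) (x : ℝ) : ℝ :=
  ∑ i : Fin φ.n, (Set.Ioc (φ.t i.castSucc) (φ.t i.succ)).indicator (fun _ => φ.a i) x

/-- The integral `∑ i, a i (X (t (i+1)) - X (t i))` of a simple function with respect to a
process `X`. -/
def integral {Ω : Type*} (φ : StepFun) (X : ℝ → Ω → ℝ) (ω : Ω) : ℝ :=
  ∑ i : Fin φ.n, φ.a i * (X (φ.t i.succ) ω - X (φ.t i.castSucc) ω)

end StepFun

/-- `X` is (a version of) the stable stochastic integral `∫ f(x) dL(x)` of `f ∈ L^α(ℝ)`: there are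
simple functions converging to `f` in `L^α(ℝ)`, and for all such sequences the integrals converge to
`X` in probability. -/
structure HasStableIntegral {Ω : Type*} [MeasurableSpace Ω] (P : Measure Ω) (α : ℝ)
    (L : ℝ → Ω → ℝ) (f : ℝ → ℝ) (X : Ω → ℝ) : Prop where
  memLp : MemLp f (ENNReal.ofReal α) volume
  aestronglyMeasurable : AEStronglyMeasurable X P
  exists_approx : ∃ φ : ℕ → StepFun,
    Tendsto (fun k => eLpNorm (fun x => (φ k).toFun x - f x) (ENNReal.ofReal α) volume)
      atTop (𝓝 0)
  tendsto : ∀ φ : ℕ → StepFun,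
    Tendsto (fun k => eLpNorm (fun x => (φ k).toFun x - f x) (ENNReal.ofReal α) volume)
      atTop (𝓝 0) →
    TendstoInMeasure P (fun k => (φ k).integral L) atTop X

/-- Right-sided Riemann–Liouville fractional integral
`(I_-^d g)(x) = Γ(d)⁻¹ ∫_x^∞ g(t) (t - x)^(d-1) dt`. -/
def fracIntegralRight (d : ℝ) (g : ℝ → ℝ) (x : ℝ) : ℝ :=
  (Real.Gamma d)⁻¹ * ∫ t in Set.Ioi x, g t * (t - x) ^ (d - 1)

/-- Left-sided Riemann–Liouville fractional integral
`(I_+^d g)(x) = Γ(d)⁻¹ ∫_{-∞}^x g(t) (x - t)^(d-1) dt`. -/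
def fracIntegralLeft (d : ℝ) (g : ℝ → ℝ) (x : ℝ) : ℝ :=
  (Real.Gamma d)⁻¹ * ∫ t in Set.Iio x, g t * (x - t) ^ (d - 1)

/-- `M` is (a version of) the linear fractional stable motion driven by `L`:
`M(t) = Γ(d+1)⁻¹ ∫ [(t - x)_+^d - (-x)_+^d] dL(x)` for every `t`. -/
def IsLinFracStableMotion {Ω : Type*} [MeasurableSpace Ω] (P : Measure Ω) (α d : ℝ)
    (L M : ℝ → Ω → ℝ) : Prop :=
  ∀ t : ℝ, HasStableIntegral P α L
    (fun x => (Real.Gamma (d + 1))⁻¹ * ((max (t - x) 0) ^ d - (max (-x) 0) ^ d)) (M t)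

/-- `Y` is (a version of) the FIMA stable process with kernel `g` driven by `L`:
`Y(t) = ∫_{-∞}^t (I_+^d g)(t - x) dL(x)` for every `t`. -/
def IsFIMA {Ω : Type*} [MeasurableSpace Ω] (P : Measure Ω) (α d : ℝ)
    (L : ℝ → Ω → ℝ) (g : ℝ → ℝ) (Y : ℝ → Ω → ℝ) : Prop :=
  ∀ t : ℝ, HasStableIntegral P α L
    ((Set.Iic t).indicator fun x => fracIntegralLeft d g (t - x)) (Y t)

/-- The norm `‖g‖_{α,p} = E[|L(1)|^p]^(1/p) ‖I_-^d g‖_α`. -/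
def alphaPNorm {Ω : Type*} [MeasurableSpace Ω] (P : Measure Ω) (α p d : ℝ)
    (L : ℝ → Ω → ℝ) (g : ℝ → ℝ) : ℝ≥0∞ :=
  eLpNorm (L 1) (ENNReal.ofReal p) P *
    eLpNorm (fracIntegralRight d g) (ENNReal.ofReal α) volume

/-- `X` is (a version of) the integral `∫ g(x) dM(x)` of `g ∈ L¹(ℝ) ∩ L^α(ℝ)` with respect to the
linear fractional stable motion `M` driven by `L`: there are simple functions converging to `g` in
`‖·‖_{α,p}`, and for all such sequences the integrals `∑ a_i (M(t_{i+1}) - M(t_i))` converge to `X`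
in `L^p(Ω, P)`. -/
structure HasLFSMIntegral {Ω : Type*} [MeasurableSpace Ω] (P : Measure Ω) (α p d : ℝ)
    (L M : ℝ → Ω → ℝ) (g : ℝ → ℝ) (X : Ω → ℝ) : Prop where
  memLp_one : MemLp g 1 volume
  memLp_alpha : MemLp g (ENNReal.ofReal α) volume
  memLp : MemLp X (ENNReal.ofReal p) P
  exists_approx : ∃ φ : ℕ → StepFun,
    Tendsto (fun k => alphaPNorm P α p d L (fun x => (φ k).toFun x - g x)) atTop (𝓝 0)
  tendsto : ∀ φ : ℕ → StepFun,
    Tendsto (fun k => alphaPNorm P α p d L (fun x => (φ k).toFun x - g x)) atTop (𝓝 0) →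
    (∀ k, MemLp ((φ k).integral M) (ENNReal.ofReal p) P) ∧
    Tendsto (fun k => eLpNorm (fun ω => (φ k).integral M ω - X ω) (ENNReal.ofReal p) P)
      atTop (𝓝 0)

open Classical in
/-- The random variable `∫ g(x) dM(x)`, determined up to a null event (and `0` if the integral does
not exist). -/
def lfsmIntegral {Ω : Type*} [MeasurableSpace Ω] (P : Measure Ω) (α p d : ℝ)
    (L M : ℝ → Ω → ℝ) (g : ℝ → ℝ) : Ω → ℝ :=
  if h : ∃ X, HasLFSMIntegral P α p d L M g X then h.choose else 0

end

/-! Everything reduces to one identity: integrating `h` against `M` is integrating `I_-^d h` against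
`L`. For an indicator this is the computation `I_-^d 1_{(s,t]}(x) = Γ(d+1)⁻¹ [(t-x)_+^d -
(s-x)_+^d]`, whose right side is the kernel of `M t - M s`; by linearity it holds for every simple
function (`fracIntegralRight_toFun`, `IsStableLimit.incr`).

The passage to the limit rests on stability. A simple integral `∫ φ dL` has the law of `‖φ‖_α L(1)`,
so its `L^p` norm is exactly `‖L(1)‖_p ‖φ‖_α`, with `‖L(1)‖_p` finite because `p < α`. By density of
simple functions and completeness of `L^p(Ω)`, the integral extends to all of `L^α(ℝ)` with the
corresponding bound. This extension is recorded as `IsStableLimit`, and it agrees with the limit in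
probability of `HasStableIntegral`. Convergence of `φ_k` to `h` in `‖·‖_{α,p}` is convergence of
`I_-^d φ_k` to `I_-^d h` in `L^α`, hence gives convergence of `∫ φ_k dM` in `L^p`
(`IsStableLimit.hasLFSMIntegral`).

Such `φ_k` exist because `I_-^d` is bounded from `L^1 ∩ L^α` to `L^α`: the kernel `u_+^(d-1)` is
integrable near `0` since `d > 0`, and lies in `L^α` near infinity since `d < 1 - 1/α`, so Young's
inequality handles the two pieces. A bounded integrable `h` is approximated in both norms at once by
truncating simple functions.

Finally, for `h(x) = g(t-x)` the reflection `x ↦ t-x` turns `I_-^d h` into `(I_+^d g)(t-x)`, the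
kernel of `Y t`. -/

/-! ### Algebra and norms of simple functions -/

namespace StepFun

/-- The sum `∑ i, a i (c (t (i+1)) - c (t i))` of a simple function along a path `c`. -/
noncomputable def incr (φ : StepFun) (c : ℝ → ℝ) : ℝ :=
  ∑ i : Fin φ.n, φ.a i * (c (φ.t i.succ) - c (φ.t i.castSucc))

lemma integral_eq_incr {Ω : Type*} (φ : StepFun) (X : ℝ → Ω → ℝ) (ω : Ω) :
    φ.integral X ω = φ.incr (fun s => X s ω) := rfl

/-- The indicator of `(s, t]` at `x` is the increment over `(s, t]` of the path `r ↦ 1_{x ≤ r}`.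
Values and integrals of a simple function are thus both instances of `incr`, and an identity valid
for all paths `c` transfers to both. -/
lemma toFun_eq_incr (φ : StepFun) (x : ℝ) :
    φ.toFun x = φ.incr (fun s => if x ≤ s then 1 else 0) := by
  unfold toFun incr
  refine Finset.sum_congr rfl fun i _ => ?_
  have h : φ.t i.castSucc < φ.t i.succ := φ.strictMono Fin.castSucc_lt_succ
  by_cases h1 : x ≤ φ.t i.castSucc
  · have h2 : x ≤ φ.t i.succ := h1.trans h.le
    simp [Set.indicator, h1, h2]
  · by_cases h2 : x ≤ φ.t i.succ
    · simp [Set.indicator, h1, h2, not_le.1 h1]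
    · simp [Set.indicator, h1, h2]

lemma sum_fin_telescope {m : ℕ} (c : Fin (m + 1) → ℝ) (p q : Fin (m + 1)) (hpq : p ≤ q) :
    ∑ j : Fin m, (if p ≤ j.castSucc ∧ j.castSucc < q then c j.succ - c j.castSucc else 0)
      = c q - c p := by
  -- Extension to `ℕ`, to telescope over `Finset.Ico p q`; the default `0` is never read, as `q ≤
  -- m`.
  set C : ℕ → ℝ := fun k => if h : k < m + 1 then c ⟨k, h⟩ else 0 with hC
  have h1 : ∀ j : Fin m, (if p ≤ j.castSucc ∧ j.castSucc < q then c j.succ - c j.castSucc else 0)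
      = (fun k : ℕ => if k ∈ Finset.Ico (p : ℕ) q then C (k + 1) - C k else 0) j := by
    intro j
    have e1 : C (j + 1) = c j.succ := by
      simp only [hC]; rw [dif_pos (by omega)]; rfl
    have e2 : C j = c j.castSucc := by
      simp only [hC]; rw [dif_pos (by omega)]; rfl
    simp only [e1, e2, Finset.mem_Ico, Fin.le_def, Fin.lt_def, Fin.val_castSucc]
  simp only [h1]
  rw [Fin.sum_univ_eq_sum_range
    (fun k : ℕ => if k ∈ Finset.Ico (p : ℕ) q then C (k + 1) - C k else 0) m,
    Finset.sum_ite_mem]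
  have h2 : Finset.range m ∩ Finset.Ico (p : ℕ) q = Finset.Ico (p : ℕ) q := by
    apply Finset.inter_eq_right.2
    intro k hk
    have := q.2
    simp only [Finset.mem_Ico, Finset.mem_range] at *
    omega
  rw [h2, Finset.sum_Ico_sub _ (by exact_mod_cast hpq)]
  simp only [hC]
  rw [dif_pos q.2, dif_pos p.2]

/-- On a grid containing all knots each increment telescopes. The coefficients `b` are chosen before
the path `c`, which is what lets two simple functions be added on a common grid. -/
lemma exists_refinement (φ : StepFun) {m : ℕ} (e : Fin (m + 1) → ℝ) (he : StrictMono e)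
    (h : ∀ i, ∃ j, e j = φ.t i) :
    ∃ b : Fin m → ℝ, ∀ c : ℝ → ℝ,
      ∑ j : Fin m, b j * (c (e j.succ) - c (e j.castSucc)) = φ.incr c := by
  choose u hu using h
  -- A fine cell receives the coefficient of the coarse interval that contains it, or `0` if there
  -- is none.
  refine ⟨fun j => ∑ i : Fin φ.n,
    if u i.castSucc ≤ j.castSucc ∧ j.castSucc < u i.succ then φ.a i else 0, fun c => ?_⟩
  simp only [Finset.sum_mul]
  rw [Finset.sum_comm]
  refine Finset.sum_congr rfl fun i _ => ?_
  have hle : u i.castSucc ≤ u i.succ := by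
    rw [← he.le_iff_le, hu, hu]
    exact (φ.strictMono Fin.castSucc_lt_succ).le
  have := sum_fin_telescope (fun j => c (e j)) _ _ hle
  simp only [hu] at this
  rw [← this, Finset.mul_sum]
  refine Finset.sum_congr rfl fun j _ => ?_
  split_ifs <;> simp

/-- Simple functions are closed under linear combinations. -/
lemma exists_add_mul (φ ψ : StepFun) (r : ℝ) :
    ∃ χ : StepFun, ∀ c : ℝ → ℝ, χ.incr c = φ.incr c + r * ψ.incr c := by
  classical
  set K : Finset ℝ := Finset.univ.image φ.t ∪ Finset.univ.image ψ.t with hK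
  have hne : K.Nonempty := ⟨φ.t 0, by simp [hK]⟩
  obtain ⟨m, hm⟩ : ∃ m, K.card = m + 1 := ⟨K.card - 1, by have := hne.card_pos; omega⟩
  set e := K.orderEmbOfFin hm with he
  have hr : ∀ x ∈ K, ∃ j, e j = x := by
    intro x hx
    have : x ∈ Set.range e := by rw [he, Finset.range_orderEmbOfFin]; exact hx
    exact this
  obtain ⟨b, hb⟩ := φ.exists_refinement e e.strictMono (fun i => hr _ (by simp [hK]))
  obtain ⟨b', hb'⟩ := ψ.exists_refinement e e.strictMono (fun i => hr _ (by simp [hK]))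
  refine ⟨⟨m, e, fun j => b j + r * b' j, e.strictMono⟩, fun c => ?_⟩
  rw [← hb, ← hb']
  simp only [incr]
  rw [Finset.mul_sum, ← Finset.sum_add_distrib]
  exact Finset.sum_congr rfl fun j _ => by ring

/-- A simple function takes the value `a i` on the `i`-th interval. -/
lemma map_toFun {M : Type*} [AddCommMonoid M] (φ : StepFun) (F : ℝ → M) (hF : F 0 = 0) (x : ℝ) :
    F (φ.toFun x) = ∑ i : Fin φ.n,
      (Set.Ioc (φ.t i.castSucc) (φ.t i.succ)).indicator (fun _ => F (φ.a i)) x := by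
  unfold toFun
  by_cases h : ∃ i : Fin φ.n, x ∈ Set.Ioc (φ.t i.castSucc) (φ.t i.succ)
  · obtain ⟨i, hi⟩ := h
    have hj : ∀ j, j ≠ i → x ∉ Set.Ioc (φ.t j.castSucc) (φ.t j.succ) := by
      intro j hji hj
      rcases lt_or_gt_of_ne hji with hlt | hlt
      · have : φ.t j.succ ≤ φ.t i.castSucc := φ.strictMono.monotone (Fin.succ_le_castSucc_iff.2 hlt)
        exact absurd (hj.2.trans this) (not_le.2 hi.1)
      · have : φ.t i.succ ≤ φ.t j.castSucc := φ.strictMono.monotone (Fin.succ_le_castSucc_iff.2 hlt)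
        exact absurd (hi.2.trans this) (not_le.2 hj.1)
    rw [Finset.sum_eq_single i, Finset.sum_eq_single i, Set.indicator_of_mem hi,
      Set.indicator_of_mem hi]
    · intro j _ hji; exact Set.indicator_of_notMem (hj j hji) _
    · simp
    · intro j _ hji; exact Set.indicator_of_notMem (hj j hji) _
    · simp
  · push Not at h
    rw [Finset.sum_eq_zero, Finset.sum_eq_zero, hF]
    · intro i _; exact Set.indicator_of_notMem (h i) _
    · intro i _; exact Set.indicator_of_notMem (h i) _

/-- Post-composition of a simple function with a map of the line. -/
def comp (φ : StepFun) (F : ℝ → ℝ) : StepFun := ⟨φ.n, φ.t, fun i => F (φ.a i), φ.strictMono⟩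

lemma toFun_comp (φ : StepFun) (F : ℝ → ℝ) (hF : F 0 = 0) (x : ℝ) :
    (φ.comp F).toFun x = F (φ.toFun x) := (φ.map_toFun F hF x).symm

lemma measurable_toFun (φ : StepFun) : Measurable φ.toFun := by
  unfold toFun
  exact Finset.measurable_fun_sum _ fun i _ => measurable_const.indicator measurableSet_Ioc

lemma lintegral_toFun (φ : StepFun) (α : ℝ) (hα : 0 < α) :
    ∫⁻ x, ‖φ.toFun x‖ₑ ^ α = ENNReal.ofReal
      (∑ i : Fin φ.n, |φ.a i| ^ α * (φ.t i.succ - φ.t i.castSucc)) := by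
  have h := fun x => φ.map_toFun (fun y => ‖y‖ₑ ^ α) (by simp [hα]) x
  simp only [h]
  rw [lintegral_finsetSum _ fun i _ => measurable_const.indicator measurableSet_Ioc,
    ENNReal.ofReal_sum_of_nonneg]
  · refine Finset.sum_congr rfl fun i _ => ?_
    rw [lintegral_indicator_const measurableSet_Ioc, Real.volume_Ioc,
      ENNReal.ofReal_mul (by positivity), ← ENNReal.ofReal_rpow_of_nonneg (abs_nonneg _) hα.le,
      Real.enorm_eq_ofReal_abs]
  · intro i _
    have : φ.t i.castSucc < φ.t i.succ := φ.strictMono Fin.castSucc_lt_succ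
    have : 0 ≤ φ.t i.succ - φ.t i.castSucc := by linarith
    positivity

lemma eLpNorm_toFun (φ : StepFun) (α : ℝ) (hα : 0 < α) :
    eLpNorm φ.toFun (ENNReal.ofReal α) volume = ENNReal.ofReal
      ((∑ i : Fin φ.n, |φ.a i| ^ α * (φ.t i.succ - φ.t i.castSucc)) ^ (1 / α)) := by
  rw [eLpNorm_eq_lintegral_rpow_enorm_toReal (by simpa) (by simp), ENNReal.toReal_ofReal hα.le,
    lintegral_toFun _ _ hα, ENNReal.ofReal_rpow_of_nonneg _ (by positivity)]
  refine Finset.sum_nonneg fun i _ => ?_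
  have : φ.t i.castSucc < φ.t i.succ := φ.strictMono Fin.castSucc_lt_succ
  have : 0 ≤ φ.t i.succ - φ.t i.castSucc := by linarith
  positivity

lemma memLp_toFun (φ : StepFun) (q : ℝ≥0∞) : MemLp φ.toFun q volume := by
  unfold toFun
  refine memLp_finsetSum _ fun i _ => ?_
  exact memLp_indicator_const _ measurableSet_Ioc _ (Or.inr (by simp))

lemma measurable_integral {Ω : Type*} [MeasurableSpace Ω] (φ : StepFun) {X : ℝ → Ω → ℝ}
    (hX : ∀ t, Measurable (X t)) : Measurable (φ.integral X) := by
  unfold integral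
  exact Finset.measurable_fun_sum _ fun i _ => ((hX _).sub (hX _)).const_mul _

end StepFun

/-! ### Law of the integral of a simple function -/

section Law

variable {Ω : Type*} [MeasurableSpace Ω] {P : Measure Ω} {α : ℝ}
  {L : ℝ → Ω → ℝ}

/-- By independence the characteristic function is a product of those of the weighted increments.
The exponents add up to `‖φ‖_α^α |θ|^α`. -/
lemma IsSymmStableMotion.charFun_integral (hL : IsSymmStableMotion P α L) (φ : StepFun) (θ : ℝ) :
    charFun (P.map (φ.integral L)) θ = (Real.exp (-((∑ i : Fin φ.n, |φ.a i| ^ α *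
      (φ.t i.succ - φ.t i.castSucc)) * |θ| ^ α)) : ℝ) := by
  have hind := (hL.indep φ.n φ.t φ.strictMono.monotone).comp (fun i x => φ.a i * x)
    (fun i => measurable_const_mul _)
  have hm : ∀ i : Fin φ.n, AEMeasurable
      ((fun x => φ.a i * x) ∘ fun ω => L (φ.t i.succ) ω - L (φ.t i.castSucc) ω) P := fun i =>
    (((hL.measurable _).sub (hL.measurable _)).const_mul _).aemeasurable
  have h1 := congrFun (hind.charFun_map_fun_sum_eq_prod hm) θ
  have h2 : φ.integral L = fun ω => ∑ i : Fin φ.n,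
      ((fun x => φ.a i * x) ∘ fun ω => L (φ.t i.succ) ω - L (φ.t i.castSucc) ω) ω := rfl
  rw [h2, h1, Finset.prod_apply]
  have h3 : ∀ i : Fin φ.n, charFun (P.map
      ((fun x => φ.a i * x) ∘ fun ω => L (φ.t i.succ) ω - L (φ.t i.castSucc) ω)) θ
      = (Real.exp (-(|φ.a i| ^ α * (φ.t i.succ - φ.t i.castSucc) * |θ| ^ α)) : ℝ) := by
    intro i
    have := charFun_map_mul_comp (μ := P) (X := Ω)
      (((hL.measurable (φ.t i.succ)).sub (hL.measurable (φ.t i.castSucc))).aemeasurable) (φ.a i) θ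
    refine this.trans ?_
    refine (hL.charFun_increment _ _ (φ.strictMono Fin.castSucc_lt_succ).le (φ.a i * θ)).trans ?_
    rw [abs_mul, Real.mul_rpow (abs_nonneg _) (abs_nonneg _)]
    congr 3; ring
  simp only [h3]
  rw [← Complex.ofReal_prod, ← Real.exp_sum, Finset.sum_neg_distrib, Finset.sum_mul]

lemma IsSymmStableMotion.charFun_one (hL : IsSymmStableMotion P α L) (θ : ℝ) :
    charFun (P.map (L 1)) θ = (Real.exp (-(|θ| ^ α)) : ℝ) := by
  have h := hL.charFun_increment 0 1 zero_le_one θ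
  have : P.map (fun ω => L 1 ω - L 0 ω) = P.map (L 1) := by
    refine Measure.map_congr ?_
    filter_upwards [hL.zero] with ω h
    simp [h]
  rw [this] at h
  rw [h]; simp

/-- The integral of a simple function has the law of `‖φ‖_α L(1)`; hence its `L^p` norm. -/
lemma IsSymmStableMotion.eLpNorm_integral [IsProbabilityMeasure P] (hL : IsSymmStableMotion P α L) (hα : 0 < α)
    (φ : StepFun) (q : ℝ≥0∞) :
    eLpNorm (φ.integral L) q P
      = eLpNorm (L 1) q P * eLpNorm φ.toFun (ENNReal.ofReal α) volume := by
  have hS : 0 ≤ ∑ i : Fin φ.n, |φ.a i| ^ α * (φ.t i.succ - φ.t i.castSucc) := by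
    refine Finset.sum_nonneg fun i _ => ?_
    have : φ.t i.castSucc < φ.t i.succ := φ.strictMono Fin.castSucc_lt_succ
    have : 0 ≤ φ.t i.succ - φ.t i.castSucc := by linarith
    positivity
  rw [φ.eLpNorm_toFun α hα]
  set S := ∑ i : Fin φ.n, |φ.a i| ^ α * (φ.t i.succ - φ.t i.castSucc) with hSdef
  have hm1 := φ.measurable_integral hL.measurable
  have hm2 : Measurable (fun ω => S ^ (1 / α) * L 1 ω) := (hL.measurable 1).const_mul _
  -- Here `S = ‖φ‖_α^α`; scaling `L 1` by `S^(1/α)` multiplies its exponent `|θ|^α` by `S`.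
  have hmap : P.map (φ.integral L) = P.map (fun ω => S ^ (1 / α) * L 1 ω) := by
    have := Measure.isProbabilityMeasure_map (μ := P) hm1.aemeasurable
    have := Measure.isProbabilityMeasure_map (μ := P) hm2.aemeasurable
    refine Measure.ext_of_charFun (funext fun θ => ?_)
    rw [hL.charFun_integral]
    refine Eq.trans ?_ (charFun_map_mul_comp (μ := P) (hL.measurable 1).aemeasurable
      (S ^ (1 / α)) θ).symm
    rw [hL.charFun_one, abs_mul, Real.mul_rpow (abs_nonneg _) (abs_nonneg _),
      abs_of_nonneg (Real.rpow_nonneg hS _), ← Real.rpow_mul hS, one_div_mul_cancel hα.ne',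
      Real.rpow_one]
  have e1 : eLpNorm (φ.integral L) q P = eLpNorm id q (P.map (φ.integral L)) := by
    rw [eLpNorm_map_measure aestronglyMeasurable_id hm1.aemeasurable]; rfl
  have e2 : eLpNorm (fun ω => S ^ (1 / α) * L 1 ω) q P
      = eLpNorm id q (P.map (fun ω => S ^ (1 / α) * L 1 ω)) := by
    rw [eLpNorm_map_measure aestronglyMeasurable_id hm2.aemeasurable]; rfl
  rw [e1, hmap, ← e2]
  have := eLpNorm_const_smul (S ^ (1 / α)) (L 1) q P
  refine this.trans ?_
  rw [Real.enorm_eq_ofReal_abs, abs_of_nonneg (Real.rpow_nonneg hS _), mul_comm]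

end Law

/-! ### Density of simple functions -/

namespace StepFun

lemma toFun_of_mem (φ : StepFun) {x : ℝ} {i : Fin φ.n}
    (hi : x ∈ Set.Ioc (φ.t i.castSucc) (φ.t i.succ)) : φ.toFun x = φ.a i := by
  unfold toFun
  rw [Finset.sum_eq_single i, Set.indicator_of_mem hi]
  · intro j _ hji
    refine Set.indicator_of_notMem (fun hj => ?_) _
    rcases lt_or_gt_of_ne hji with hlt | hlt
    · have : φ.t j.succ ≤ φ.t i.castSucc := φ.strictMono.monotone (Fin.succ_le_castSucc_iff.2 hlt)
      exact absurd (hj.2.trans this) (not_le.2 hi.1)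
    · have : φ.t i.succ ≤ φ.t j.castSucc := φ.strictMono.monotone (Fin.succ_le_castSucc_iff.2 hlt)
      exact absurd (hi.2.trans this) (not_le.2 hj.1)
  · simp

lemma toFun_of_notMem (φ : StepFun) {x : ℝ}
    (h : ∀ i : Fin φ.n, x ∉ Set.Ioc (φ.t i.castSucc) (φ.t i.succ)) : φ.toFun x = 0 :=
  Finset.sum_eq_zero fun i _ => Set.indicator_of_notMem (h i) _

/-- Uniform approximation of a continuous function on `(-N, N]` by simple functions. -/
lemma exists_dist_le_of_continuous {f : ℝ → ℝ} (hf : UniformContinuous f) {N : ℝ} (hN : 0 < N)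
    {ε : ℝ} (hε : 0 < ε) :
    ∃ φ : StepFun, (∀ x ∈ Set.Ioc (-N) N, |φ.toFun x - f x| ≤ ε) ∧
      ∀ x ∉ Set.Ioc (-N) N, φ.toFun x = 0 := by
  obtain ⟨δ, hδ, hfδ⟩ := Metric.uniformContinuous_iff.1 hf ε hε
  obtain ⟨m, hm⟩ := exists_nat_gt (2 * N / δ)
  have hm0 : (0 : ℝ) < m := lt_of_le_of_lt (by positivity) hm
  set s : ℝ := 2 * N / m with hs
  have hs0 : 0 < s := by positivity
  have hsδ : s < δ := by
    rw [hs, div_lt_iff₀ hm0]; rwa [div_lt_iff₀ hδ, mul_comm (m : ℝ)] at hm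
  have hms : m * s = 2 * N := by rw [hs]; field_simp
  refine ⟨⟨m, fun i => -N + i * s, fun i => f (-N + (i + 1) * s), ?_⟩, ?_, ?_⟩
  · intro i j hij
    have : ((i : ℕ) : ℝ) < ((j : ℕ) : ℝ) := by exact_mod_cast hij
    have := mul_lt_mul_of_pos_right this hs0
    dsimp only
    linarith
  · intro x hx
    have hpos : 0 < (x + N) / s := div_pos (by linarith [hx.1]) hs0
    have hle : (x + N) / s ≤ m := by rw [div_le_iff₀ hs0, hms]; linarith [hx.2]
    have hc1 : 0 < ⌈(x + N) / s⌉₊ := Nat.ceil_pos.2 hpos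
    have hc2 : ⌈(x + N) / s⌉₊ ≤ m := Nat.ceil_le.2 hle
    -- The cells are closed on the right, so the ceiling gives the index of the right endpoint of
    -- the cell containing `x`, which is where `f` is sampled.
    obtain ⟨k, hk⟩ : ∃ k, ⌈(x + N) / s⌉₊ = k + 1 := ⟨_, (Nat.sub_add_cancel hc1).symm⟩
    have hk1 : (x + N) / s ≤ k + 1 := by
      have := Nat.le_ceil ((x + N) / s); rw [hk] at this; exact_mod_cast this
    have hk2 : k < (x + N) / s := by
      refine Nat.lt_ceil.1 ?_; omega
    rw [div_le_iff₀ hs0] at hk1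
    rw [lt_div_iff₀ hs0] at hk2
    have hkm : k < m := by omega
    rw [toFun_of_mem (i := ⟨k, hkm⟩)]
    · dsimp only
      rw [← Real.dist_eq]
      refine (hfδ ?_).le
      rw [Real.dist_eq, abs_lt]
      constructor <;> linarith
    · constructor
      · simp only [Fin.val_castSucc]; linarith
      · simp only [Fin.val_succ]; push_cast; linarith
  · intro x hx
    refine toFun_of_notMem _ fun i hi => hx ?_
    simp only [Fin.val_castSucc, Fin.val_succ] at hi
    push_cast at hi
    have h1 : (0 : ℝ) ≤ (i : ℕ) * s := by positivity
    have h2 : (((i : ℕ) : ℝ) + 1) * s ≤ m * s := by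
      refine mul_le_mul_of_nonneg_right ?_ hs0.le
      exact_mod_cast i.2
    exact ⟨by linarith [hi.1], by linarith [hi.2]⟩

/-- Simple functions are dense in `L^q(ℝ)`. -/
lemma exists_eLpNorm_sub_le {f : ℝ → ℝ} {q : ℝ≥0∞} (hq1 : 1 ≤ q) (hq : q ≠ ∞)
    (hf : MemLp f q volume) {ε : ℝ≥0∞} (hε : ε ≠ 0) :
    ∃ φ : StepFun, eLpNorm (fun x => φ.toFun x - f x) q volume ≤ ε := by
  have hε2 : ε / 2 ≠ 0 := (ENNReal.half_pos hε).ne'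
  obtain ⟨h, hsupp, hfh, hcont, hmem⟩ := hf.exists_hasCompactSupport_eLpNorm_sub_le hq hε2
  have huc := hsupp.uniformContinuous_of_continuous hcont
  obtain ⟨N, hN⟩ := hsupp.isCompact.isBounded.subset_ball_lt 0 0
  have hN0 := hN.1
  have hz : ∀ x ∉ Set.Ioc (-N) N, h x = 0 := by
    intro x hx
    refine image_eq_zero_of_notMem_tsupport fun hx' => hx ?_
    have := hN.2 hx'
    rw [Real.ball_eq_Ioo] at this
    exact ⟨by linarith [this.1], by linarith [this.2]⟩
  have hV : volume (Set.Ioc (-N) N) ^ (1 / q.toReal) ≠ ∞ := by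
    refine ENNReal.rpow_ne_top_of_nonneg (by positivity) (by simp)
  obtain ⟨η, hη, hηε⟩ : ∃ η : ℝ, 0 < η ∧
      ENNReal.ofReal η * volume (Set.Ioc (-N) N) ^ (1 / q.toReal) ≤ ε / 2 := by
    have ht : Tendsto (fun η : ℝ => ENNReal.ofReal η *
        volume (Set.Ioc (-N) N) ^ (1 / q.toReal)) (𝓝[>] 0) (𝓝 0) := by
      have h0 : Tendsto (fun η : ℝ => ENNReal.ofReal η) (𝓝[>] 0) (𝓝 0) := by
        have := (ENNReal.continuous_ofReal.tendsto 0).mono_left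
          (nhdsWithin_le_nhds (s := Set.Ioi 0))
        simpa using this
      have := ENNReal.Tendsto.mul_const h0 (Or.inr hV)
      simpa using this
    have hev := ht.eventually (ge_mem_nhds (pos_iff_ne_zero.2 hε2))
    obtain ⟨η, h1, h2⟩ := (hev.and self_mem_nhdsWithin).exists
    exact ⟨η, h2, h1⟩
  obtain ⟨φ, hφ1, hφ2⟩ := exists_dist_le_of_continuous huc hN0 hη
  refine ⟨φ, ?_⟩
  have h1 : eLpNorm (fun x => φ.toFun x - h x) q volume ≤ ε / 2 := by
    have hb : ∀ x, ‖φ.toFun x - h x‖ ≤ (Set.Ioc (-N) N).indicator (fun _ => η) x := by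
      intro x
      by_cases hx : x ∈ Set.Ioc (-N) N
      · rw [Set.indicator_of_mem hx]; exact hφ1 x hx
      · rw [Set.indicator_of_notMem hx, hφ2 x hx, hz x hx]; simp
    refine (eLpNorm_mono_real hb).trans ?_
    rw [eLpNorm_indicator_const measurableSet_Ioc (by positivity) hq,
      Real.enorm_eq_ofReal_abs, abs_of_pos hη]
    exact hηε
  have h2 : (fun x => φ.toFun x - f x) = (fun x => φ.toFun x - h x) - (f - h) := by
    ext x; simp
  rw [h2]
  refine (eLpNorm_sub_le (φ.measurable_toFun.sub hcont.measurable).aestronglyMeasurable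
    (hf.1.sub hmem.1) hq1).trans ?_
  calc _ ≤ ε / 2 + ε / 2 := add_le_add h1 hfh
    _ = ε := ENNReal.add_halves ε

lemma exists_tendsto_eLpNorm {f : ℝ → ℝ} {q : ℝ≥0∞} (hq1 : 1 ≤ q) (hq : q ≠ ∞)
    (hf : MemLp f q volume) :
    ∃ φ : ℕ → StepFun,
      Tendsto (fun k => eLpNorm (fun x => (φ k).toFun x - f x) q volume) atTop (𝓝 0) := by
  have h : ∀ k : ℕ, ∃ φ : StepFun,
      eLpNorm (fun x => φ.toFun x - f x) q volume ≤ (k : ℝ≥0∞)⁻¹ := fun k =>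
    exists_eLpNorm_sub_le hq1 hq hf (by simp)
  choose φ hφ using h
  exact ⟨φ, tendsto_of_tendsto_of_tendsto_of_le_of_le tendsto_const_nhds
    ENNReal.tendsto_inv_nat_nhds_zero (fun _ => zero_le) hφ⟩

end StepFun

/-- Clamping to `[-B, B]` is `1`-Lipschitz and fixes `y`. Truncating the approximants of a function
bounded by `B` therefore never worsens them. -/
lemma abs_clamp_sub_le {B x y : ℝ} (hy : |y| ≤ B) :
    |max (-B) (min x B) - y| ≤ |x - y| := by
  have h1 : y = max (-B) (min y B) := by
    rw [min_eq_left (abs_le.1 hy).2, max_eq_right (abs_le.1 hy).1]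
  conv_lhs => rw [h1]
  rw [max_comm, max_comm (-B)]
  exact (abs_max_sub_max_le_abs _ _ _).trans (by
    rw [min_comm, min_comm y]
    have := abs_min_sub_min_le_max B x B y
    simpa using this)

/-- A function bounded by `B` has `L^α` norm controlled by its `L^1` norm. -/
lemma eLpNorm_le_of_bound_of_one_le {f : ℝ → ℝ} {B α : ℝ} (hα : 1 ≤ α) (hB : ∀ x, |f x| ≤ B) :
    eLpNorm f (ENNReal.ofReal α) volume
      ≤ (ENNReal.ofReal B ^ (α - 1) * eLpNorm f 1 volume) ^ (1 / α) := by
  have hα0 : 0 < α := by linarith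
  rw [eLpNorm_eq_lintegral_rpow_enorm_toReal (by simpa) (by simp), ENNReal.toReal_ofReal hα0.le,
    eLpNorm_one_eq_lintegral_enorm]
  refine ENNReal.rpow_le_rpow ?_ (by positivity)
  rw [← lintegral_const_mul' _ _ (ENNReal.rpow_ne_top_of_nonneg (by linarith) (by simp))]
  refine lintegral_mono fun x => ?_
  have h : ‖f x‖ₑ ^ α = ‖f x‖ₑ ^ (α - 1) * ‖f x‖ₑ := by
    conv_rhs => rw [← ENNReal.rpow_one ‖f x‖ₑ, ← ENNReal.rpow_mul, one_mul]
    rw [← ENNReal.rpow_add_of_nonneg _ _ (by linarith) (by linarith)]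
    congr 1; ring
  dsimp only
  rw [h]
  gcongr
  rw [Real.enorm_eq_ofReal_abs]
  exact ENNReal.ofReal_le_ofReal (hB x)

/-- A bounded integrable function is approximated by simple functions in `L^1` and `L^α` at the
same time. -/
lemma StepFun.exists_tendsto_eLpNorm_one_and {f : ℝ → ℝ} (hf : MemLp f 1 volume) {B α : ℝ}
    (hα : 1 ≤ α) (hB : ∀ x, |f x| ≤ B) :
    ∃ φ : ℕ → StepFun,
      Tendsto (fun k => eLpNorm (fun x => (φ k).toFun x - f x) 1 volume) atTop (𝓝 0) ∧
      Tendsto (fun k => eLpNorm (fun x => (φ k).toFun x - f x) (ENNReal.ofReal α) volume)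
        atTop (𝓝 0) := by
  obtain ⟨φ, hφ⟩ := StepFun.exists_tendsto_eLpNorm le_rfl (by simp) hf
  have hB0 : 0 ≤ B := (abs_nonneg _).trans (hB 0)
  have hα0 : 0 < α := by linarith
  set F : ℝ → ℝ := fun x => max (-B) (min x B) with hF
  have hF0 : F 0 = 0 := by simp [hF, hB0]
  have hle1 : ∀ k, eLpNorm (fun x => ((φ k).comp F).toFun x - f x) 1 volume
      ≤ eLpNorm (fun x => (φ k).toFun x - f x) 1 volume := by
    intro k
    refine eLpNorm_mono fun x => ?_
    rw [StepFun.toFun_comp _ _ hF0]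
    exact abs_clamp_sub_le (hB x)
  have ht1 : Tendsto (fun k => eLpNorm (fun x => ((φ k).comp F).toFun x - f x) 1 volume)
      atTop (𝓝 0) :=
    tendsto_of_tendsto_of_tendsto_of_le_of_le tendsto_const_nhds hφ (fun _ => zero_le) hle1
  -- The truncated errors are bounded by `2 * B`, so their `L^1` convergence forces `L^α`
  -- convergence.
  refine ⟨fun k => (φ k).comp F, ht1, ?_⟩
  have hb : ∀ k x, |((φ k).comp F).toFun x - f x| ≤ 2 * B := by
    intro k x
    rw [StepFun.toFun_comp _ _ hF0]
    have h1 : |F ((φ k).toFun x)| ≤ B :=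
      abs_le.2 ⟨le_max_left _ _, max_le (by linarith) (min_le_right _ _)⟩
    calc _ ≤ |F ((φ k).toFun x)| + |f x| := abs_sub _ _
      _ ≤ 2 * B := by linarith [hB x]
  have ht2 : Tendsto (fun k => (ENNReal.ofReal (2 * B) ^ (α - 1) *
      eLpNorm (fun x => ((φ k).comp F).toFun x - f x) 1 volume) ^ (1 / α)) atTop (𝓝 0) := by
    have h1 := ENNReal.Tendsto.const_mul (a := ENNReal.ofReal (2 * B) ^ (α - 1)) ht1
      (Or.inr (ENNReal.rpow_ne_top_of_nonneg (by linarith) ENNReal.ofReal_ne_top))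
    have h2 := h1.ennrpow_const (1 / α)
    rwa [mul_zero, ENNReal.zero_rpow_of_pos (by positivity)] at h2
  exact tendsto_of_tendsto_of_tendsto_of_le_of_le tendsto_const_nhds ht2 (fun _ => zero_le)
    fun k => eLpNorm_le_of_bound_of_one_le hα (hb k)

/-! ### Moments of order below `α` of a stable variable -/

section Moment

/-- The weight `∫_0^∞ (1 - cos u) u^{-1-p} du`. -/
noncomputable def cosWeight (p : ℝ) : ℝ≥0∞ :=
  ∫⁻ u in Set.Ioi (0 : ℝ), ENNReal.ofReal ((1 - Real.cos u) * u ^ (-1 - p))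

lemma cosWeight_pos (p : ℝ) : 0 < cosWeight p := by
  unfold cosWeight
  rw [setLIntegral_pos_iff (by fun_prop)]
  have hsub : Set.Ioo (0 : ℝ) 1 ⊆ Function.support
      (fun u : ℝ => ENNReal.ofReal ((1 - Real.cos u) * u ^ (-1 - p))) ∩ Set.Ioi 0 := by
    intro u hu
    refine ⟨?_, hu.1⟩
    have h1 : Real.cos u < 1 := by
      have := Real.cos_lt_cos_of_nonneg_of_le_pi (x := 0) (y := u) le_rfl
        (by linarith [hu.2, Real.pi_gt_three]) hu.1
      simpa using this
    have h2 := Real.rpow_pos_of_pos hu.1 (-1 - p)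
    simp only [Function.mem_support, ne_eq, ENNReal.ofReal_eq_zero, not_le]
    exact mul_pos (by linarith) h2
  refine lt_of_lt_of_le ?_ (measure_mono hsub)
  simp

/-- Substitute `u = |x| θ` and use that cosine is even. This expresses `|x|^p` through `cos (θ x)`,
whose expectation is the real part of a characteristic function. -/
lemma lintegral_one_sub_cos_mul {p : ℝ} (hp : 0 < p) (x : ℝ) :
    ∫⁻ θ in Set.Ioi (0 : ℝ), ENNReal.ofReal ((1 - Real.cos (θ * x)) * θ ^ (-1 - p))
      = ‖x‖ₑ ^ p * cosWeight p := by
  rcases eq_or_ne x 0 with rfl | hx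
  · simp [hp]
  have hx0 : 0 < |x| := abs_pos.2 hx
  have hscale : ∀ G : ℝ → ℝ≥0∞, Measurable G →
      ∫⁻ θ, G (|x| * θ) = ENNReal.ofReal |x|⁻¹ * ∫⁻ u, G u := by
    intro G hG
    rw [← lintegral_map hG (measurable_const_mul _), Real.map_volume_mul_left hx0.ne',
      lintegral_smul_measure, abs_of_pos (inv_pos.2 hx0), smul_eq_mul]
  have hG : Measurable ((Set.Ioi (0 : ℝ)).indicator
      fun u : ℝ => ENNReal.ofReal ((1 - Real.cos u) * u ^ (-1 - p))) :=
    Measurable.indicator (by fun_prop) measurableSet_Ioi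
  have h := hscale _ hG
  rw [lintegral_indicator measurableSet_Ioi] at h
  have h2 : ∀ θ, (Set.Ioi (0 : ℝ)).indicator
      (fun θ => ENNReal.ofReal ((1 - Real.cos (θ * x)) * θ ^ (-1 - p))) θ
      = ENNReal.ofReal (|x| ^ (1 + p)) * (Set.Ioi (0 : ℝ)).indicator
        (fun u : ℝ => ENNReal.ofReal ((1 - Real.cos u) * u ^ (-1 - p))) (|x| * θ) := by
    intro θ
    by_cases hθ : 0 < θ
    · have hθx : 0 < |x| * θ := mul_pos hx0 hθ
      rw [Set.indicator_of_mem (show θ ∈ Set.Ioi (0 : ℝ) from hθ),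
        Set.indicator_of_mem (show |x| * θ ∈ Set.Ioi (0 : ℝ) from hθx),
        ← ENNReal.ofReal_mul (by positivity)]
      have hc : Real.cos (|x| * θ) = Real.cos (θ * x) := by
        rw [← Real.cos_abs (θ * x), abs_mul, abs_of_pos hθ, mul_comm]
      have hr : |x| ^ (1 + p) * (|x| * θ) ^ (-1 - p) = θ ^ (-1 - p) := by
        rw [Real.mul_rpow hx0.le hθ.le, ← mul_assoc, ← Real.rpow_add hx0]
        simp
      rw [hc, mul_left_comm, hr]
    · rw [Set.indicator_of_notMem (by simpa using hθ), Set.indicator_of_notMem, mul_zero]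
      simp only [Set.mem_Ioi, not_lt] at *
      exact mul_nonpos_of_nonneg_of_nonpos hx0.le hθ
  rw [← lintegral_indicator measurableSet_Ioi]
  simp only [h2]
  rw [lintegral_const_mul' _ _ ENNReal.ofReal_ne_top, h, ← mul_assoc,
    ← ENNReal.ofReal_mul (by positivity), Real.enorm_eq_ofReal_abs,
    ENNReal.ofReal_rpow_of_nonneg hx0.le hp.le]
  congr 2
  rw [Real.rpow_add hx0, Real.rpow_one, mul_comm, ← mul_assoc, inv_mul_cancel₀ hx0.ne', one_mul]

/-- Near `0`, `1 - exp (-θ^α) ≤ θ^α` leaves `θ^(α-1-p)`, integrable since `p < α`; beyond `1` the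
factor is at most `1` and `θ^(-1-p)` is integrable since `p > 0`. -/
lemma lintegral_one_sub_exp_lt_top {p α : ℝ} (hp : 0 < p) (hpα : p < α) :
    ∫⁻ θ in Set.Ioi (0 : ℝ), ENNReal.ofReal ((1 - Real.exp (-(|θ| ^ α))) * θ ^ (-1 - p)) < ∞ := by
  rw [← Set.Ioc_union_Ioi_eq_Ioi (zero_le_one' ℝ)]
  refine (lintegral_union_le _ _ _).trans_lt (ENNReal.add_lt_top.2 ⟨?_, ?_⟩)
  · have hi : IntegrableOn (fun θ : ℝ => θ ^ (α - 1 - p)) (Set.Ioc 0 1) volume :=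
      (intervalIntegrable_iff_integrableOn_Ioc_of_le zero_le_one).1
        (intervalIntegral.intervalIntegrable_rpow' (by linarith))
    refine lt_of_le_of_lt (setLIntegral_mono' measurableSet_Ioc fun θ hθ => ?_)
      hi.lintegral_lt_top
    refine ENNReal.ofReal_le_ofReal ?_
    rw [abs_of_pos hθ.1]
    have h1 := Real.add_one_le_exp (-(θ ^ α))
    have h2 : θ ^ (α - 1 - p) = θ ^ α * θ ^ (-1 - p) := by
      rw [← Real.rpow_add hθ.1]; congr 1; ring
    rw [h2]
    exact mul_le_mul_of_nonneg_right (by linarith) (Real.rpow_nonneg hθ.1.le _)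
  · have hi : IntegrableOn (fun θ : ℝ => θ ^ (-1 - p)) (Set.Ioi 1) volume :=
      integrableOn_Ioi_rpow_of_lt (by linarith) zero_lt_one
    refine lt_of_le_of_lt (setLIntegral_mono' measurableSet_Ioi fun θ hθ => ?_)
      hi.lintegral_lt_top
    refine ENNReal.ofReal_le_ofReal ?_
    have h1 := Real.exp_pos (-(|θ| ^ α))
    have hθ0 : (0 : ℝ) ≤ θ := zero_le_one.trans (le_of_lt hθ)
    exact mul_le_of_le_one_left (Real.rpow_nonneg hθ0 _) (by linarith)

variable {Ω : Type*} [MeasurableSpace Ω] {P : Measure Ω} [IsProbabilityMeasure P] {α : ℝ}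
  {L : ℝ → Ω → ℝ}

/-- A symmetric `α`-stable variable has finite moments of every order `p < α`. -/
lemma memLp_of_charFun_eq_exp {X : Ω → ℝ} (hX : Measurable X)
    (hchar : ∀ θ, charFun (P.map X) θ = (Real.exp (-(|θ| ^ α)) : ℝ))
    {p : ℝ} (hp : 0 < p) (hpα : p < α) : MemLp X (ENNReal.ofReal p) P := by
  refine ⟨hX.aestronglyMeasurable, ?_⟩
  rw [eLpNorm_lt_top_iff_lintegral_rpow_enorm_lt_top (by simpa) (by simp),
    ENNReal.toReal_ofReal hp.le]
  have hcos : ∀ θ, ∫ ω, (1 - Real.cos (θ * X ω)) ∂P = 1 - Real.exp (-(|θ| ^ α)) := by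
    intro θ
    have hi : Integrable (fun ω => Complex.exp (θ * X ω * Complex.I)) P := by
      refine Integrable.of_bound (C := 1) (by fun_prop) (Eventually.of_forall fun ω => ?_)
      rw [← Complex.ofReal_mul, Complex.norm_exp_ofReal_mul_I]
    have h1 := hchar θ
    rw [charFun_apply_real, integral_map hX.aemeasurable (by fun_prop)] at h1
    have h2 := congrArg Complex.re h1
    have h3 := integral_re hi
    simp only [RCLike.re_eq_complex_re] at h3
    rw [← h3, Complex.ofReal_re] at h2
    have h4 : ∀ ω, (Complex.exp (θ * X ω * Complex.I)).re = Real.cos (θ * X ω) := by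
      intro ω
      rw [← Complex.ofReal_mul, Complex.exp_ofReal_mul_I_re]
    simp only [h4] at h2
    rw [integral_sub (integrable_const _), h2]
    · simp
    · have := hi.re
      simpa only [RCLike.re_eq_complex_re, h4] using this
  have hfub : ∫⁻ ω, ‖X ω‖ₑ ^ p * cosWeight p ∂P
      = ∫⁻ θ in Set.Ioi (0 : ℝ), ENNReal.ofReal ((1 - Real.exp (-(|θ| ^ α))) * θ ^ (-1 - p)) := by
    simp only [← lintegral_one_sub_cos_mul hp]
    rw [lintegral_lintegral_swap (by fun_prop)]
    refine setLIntegral_congr_fun measurableSet_Ioi fun θ hθ => ?_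
    have hr : 0 ≤ θ ^ (-1 - p) := Real.rpow_nonneg (le_of_lt hθ) _
    rw [← hcos, ← integral_mul_const, ofReal_integral_eq_lintegral_ofReal]
    · refine Integrable.mul_const ?_ _
      refine Integrable.of_bound (C := 2) (by fun_prop) (Eventually.of_forall fun ω => ?_)
      rw [Real.norm_eq_abs, abs_le]
      constructor <;> linarith [Real.cos_le_one (θ * X ω), Real.neg_one_le_cos (θ * X ω)]
    · refine Eventually.of_forall fun ω => mul_nonneg ?_ hr
      linarith [Real.cos_le_one (θ * X ω)]
  rw [lintegral_mul_const _ (by fun_prop)] at hfub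
  -- Only positivity of `cosWeight p` is needed: an infinite moment would make the left side of
  -- `hfub` infinite, whatever the weight.
  by_contra htop
  rw [not_lt, top_le_iff] at htop
  rw [htop, ENNReal.top_mul (cosWeight_pos p).ne'] at hfub
  exact (lintegral_one_sub_exp_lt_top hp hpα).ne hfub.symm

lemma IsSymmStableMotion.memLp_one (hL : IsSymmStableMotion P α L) {p : ℝ} (hp : 0 < p)
    (hpα : p < α) : MemLp (L 1) (ENNReal.ofReal p) P :=
  memLp_of_charFun_eq_exp (hL.measurable 1) hL.charFun_one hp hpα

/-- Otherwise `L 1 = 0` almost surely and its characteristic function at `1` would be `1` instead of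
`exp (-1)`. This allows the moment to be cancelled from `alphaPNorm`. -/
lemma IsSymmStableMotion.eLpNorm_one_ne_zero (hL : IsSymmStableMotion P α L) {p : ℝ} (hp : 0 < p) :
    eLpNorm (L 1) (ENNReal.ofReal p) P ≠ 0 := by
  intro h
  rw [eLpNorm_eq_zero_iff (hL.measurable 1).aestronglyMeasurable (by simpa)] at h
  have h1 := hL.charFun_one 1
  have h2 : P.map (L 1) = P.map (fun _ => (0 : ℝ)) := Measure.map_congr h
  rw [h2, Measure.map_const, measure_univ, one_smul, charFun_dirac] at h1
  simp only [inner_zero_left, Complex.ofReal_zero, zero_mul, Complex.exp_zero, abs_one,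
    Real.one_rpow] at h1
  have h3 : Real.exp (-1) = 1 := by exact_mod_cast h1.symm
  rw [Real.exp_eq_one_iff] at h3
  norm_num at h3

end Moment

/-! ### Young's inequality and the fractional integral -/

section Young

/-- Hölder's inequality with a weight. -/
lemma lintegral_mul_rpow_le {β : Type*} [MeasurableSpace β] {μ : Measure β} {α : ℝ} (hα : 1 ≤ α)
    {W G : β → ℝ≥0∞} (hW : AEMeasurable W μ) (hG : AEMeasurable G μ) :
    (∫⁻ u, W u * G u ∂μ) ^ α ≤ (∫⁻ u, W u ∂μ) ^ (α - 1) * ∫⁻ u, W u * G u ^ α ∂μ := by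
  have hα0 : 0 < α := by linarith
  have h1α : 0 ≤ 1 - 1 / α := by
    rw [sub_nonneg, div_le_one hα0]; exact hα
  -- Hölder for the splitting `W G = W^(1-1/α) (W G^α)^(1/α)`.
  have h := ENNReal.lintegral_mul_norm_pow_le hW (hW.mul (hG.pow_const α)) h1α
    (q := 1 / α) (by positivity) (by ring)
  have hpt : ∀ u, W u ^ (1 - 1 / α) * (W u * G u ^ α) ^ (1 / α) = W u * G u := by
    intro u
    rw [ENNReal.mul_rpow_of_nonneg _ _ (by positivity), ← ENNReal.rpow_mul,
      mul_one_div_cancel hα0.ne', ENNReal.rpow_one, ← mul_assoc,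
      ← ENNReal.rpow_add_of_nonneg _ _ h1α (by positivity), sub_add_cancel, ENNReal.rpow_one]
  simp only [Pi.mul_apply, hpt] at h
  have h2 := ENNReal.rpow_le_rpow h hα0.le
  rw [ENNReal.mul_rpow_of_nonneg _ _ hα0.le, ← ENNReal.rpow_mul, ← ENNReal.rpow_mul,
    one_div_mul_cancel hα0.ne', ENNReal.rpow_one] at h2
  refine h2.trans_eq ?_
  congr 2
  field_simp

/-- Minkowski's integral inequality for a uniformly bounded family. -/
lemma lintegral_lintegral_rpow_le {β γ : Type*} [MeasurableSpace β] [MeasurableSpace γ]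
    {μ : Measure β} {ν : Measure γ} [SFinite μ] [SFinite ν] {α : ℝ} (hα : 1 ≤ α)
    {W : β → ℝ≥0∞} {G : γ → β → ℝ≥0∞} (hW : Measurable W) (hG : Measurable (Function.uncurry G))
    {S : ℝ≥0∞} (hS : ∀ u, ∫⁻ x, G x u ^ α ∂ν ≤ S) :
    ∫⁻ x, (∫⁻ u, W u * G x u ∂μ) ^ α ∂ν ≤ (∫⁻ u, W u ∂μ) ^ α * S := by
  have hα0 : 0 < α := by linarith
  calc ∫⁻ x, (∫⁻ u, W u * G x u ∂μ) ^ α ∂ν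
      ≤ ∫⁻ x, (∫⁻ u, W u ∂μ) ^ (α - 1) * ∫⁻ u, W u * G x u ^ α ∂μ ∂ν :=
        lintegral_mono fun x => lintegral_mul_rpow_le hα hW.aemeasurable
          (hG.comp measurable_prodMk_left).aemeasurable
    _ = (∫⁻ u, W u ∂μ) ^ (α - 1) * ∫⁻ x, ∫⁻ u, W u * G x u ^ α ∂μ ∂ν :=
        lintegral_const_mul _ (Measurable.lintegral_prod_right'
          (f := fun z : γ × β => W z.2 * G z.1 z.2 ^ α)
          ((hW.comp measurable_snd).mul (hG.pow_const α)))
    _ = (∫⁻ u, W u ∂μ) ^ (α - 1) * ∫⁻ u, ∫⁻ x, W u * G x u ^ α ∂ν ∂μ := by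
        rw [lintegral_lintegral_swap]
        exact ((hW.comp measurable_snd).mul (hG.pow_const α)).aemeasurable
    _ ≤ (∫⁻ u, W u ∂μ) ^ (α - 1) * ∫⁻ u, W u * S ∂μ := by
        gcongr with u
        have hGu : Measurable fun x => G x u ^ α :=
          (hG.comp measurable_prodMk_right).pow_const α
        rw [lintegral_const_mul _ hGu]
        gcongr
        exact hS u
    _ = (∫⁻ u, W u ∂μ) ^ α * S := by
        rw [lintegral_mul_const _ hW, ← mul_assoc]
        congr 1
        conv_lhs => rw [← ENNReal.rpow_one (∫⁻ u, W u ∂μ), ← ENNReal.rpow_mul, one_mul]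
        rw [← ENNReal.rpow_add_of_nonneg _ _ (by linarith) zero_le_one, sub_add_cancel]

/-- Young's inequality, kernel in `L^α`. -/
lemma lintegral_conv_rpow_le_right {α : ℝ} (hα : 1 ≤ α) {F K : ℝ → ℝ≥0∞} (hF : Measurable F)
    (hK : Measurable K) :
    ∫⁻ x, (∫⁻ t, F t * K (t - x)) ^ α ≤ (∫⁻ t, F t) ^ α * ∫⁻ u, K u ^ α := by
  refine lintegral_lintegral_rpow_le hα hF (G := fun x t => K (t - x))
    (hK.comp (measurable_snd.sub measurable_fst)) fun t => ?_
  exact (lintegral_sub_left_eq_self (fun u => K u ^ α) t).le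

/-- Young's inequality, kernel in `L^1`. -/
lemma lintegral_conv_rpow_le_left {α : ℝ} (hα : 1 ≤ α) {F K : ℝ → ℝ≥0∞} (hF : Measurable F)
    (hK : Measurable K) :
    ∫⁻ x, (∫⁻ t, F t * K (t - x)) ^ α ≤ (∫⁻ u, K u) ^ α * ∫⁻ t, F t ^ α := by
  have h : ∀ x, ∫⁻ t, F t * K (t - x) = ∫⁻ u, K u * F (u + x) := by
    intro x
    rw [← lintegral_sub_right_eq_self (fun u => K u * F (u + x)) x]
    simp [mul_comm]
  simp only [h]
  refine lintegral_lintegral_rpow_le hα hK (G := fun x u => F (u + x))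
    (hF.comp (measurable_snd.add measurable_fst)) fun u => ?_
  exact (lintegral_add_left_eq_self (fun x => F x ^ α) u).le

/-- The kernel `u_+^(d-1)` of the fractional integral. -/
noncomputable def fracKernel (d u : ℝ) : ℝ := (Set.Ioi (0 : ℝ)).indicator (fun u => u ^ (d - 1)) u

lemma measurable_fracKernel (d : ℝ) : Measurable (fracKernel d) :=
  Measurable.indicator (by fun_prop) measurableSet_Ioi

lemma fracKernel_sub_mul (d : ℝ) (f : ℝ → ℝ) (x : ℝ) :
    (fun t => f t * fracKernel d (t - x))
      = (Set.Ioi x).indicator fun t => f t * (t - x) ^ (d - 1) := by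
  ext t
  by_cases h : x < t
  · simp [fracKernel, Set.indicator, h]
  · simp [fracKernel, Set.indicator, h]

lemma fracIntegralRight_eq_integral (d : ℝ) (f : ℝ → ℝ) (x : ℝ) :
    fracIntegralRight d f x = (Real.Gamma d)⁻¹ * ∫ t, f t * fracKernel d (t - x) := by
  rw [fracIntegralRight, fracKernel_sub_mul, integral_indicator measurableSet_Ioi]

lemma fracIntegralRight_congr_ae {d : ℝ} {f g : ℝ → ℝ} (h : f =ᵐ[volume] g) :
    fracIntegralRight d f = fracIntegralRight d g := by
  ext x
  rw [fracIntegralRight_eq_integral, fracIntegralRight_eq_integral]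
  congr 1
  refine integral_congr_ae ?_
  filter_upwards [h] with t ht
  rw [ht]

lemma aestronglyMeasurable_fracIntegralRight {d : ℝ} {f : ℝ → ℝ}
    (hf : AEStronglyMeasurable f volume) :
    AEStronglyMeasurable (fracIntegralRight d f) volume := by
  rw [fracIntegralRight_congr_ae hf.ae_eq_mk]
  have hm := hf.stronglyMeasurable_mk.measurable
  have h : fracIntegralRight d (hf.mk f) = fun x => (Real.Gamma d)⁻¹ *
      ∫ t, hf.mk f t * fracKernel d (t - x) := by
    ext x; exact fracIntegralRight_eq_integral _ _ _
  rw [h]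
  refine AEStronglyMeasurable.const_mul ?_ _
  refine (StronglyMeasurable.integral_prod_right'
    (f := fun z : ℝ × ℝ => hf.mk f z.2 * fracKernel d (z.2 - z.1)) ?_).aestronglyMeasurable
  exact ((hm.comp measurable_snd).mul
    ((measurable_fracKernel d).comp (measurable_snd.sub measurable_fst))).stronglyMeasurable

lemma lintegral_fracKernel_Iic_lt_top {d : ℝ} (hd : 0 < d) :
    ∫⁻ u, (Set.Iic (1 : ℝ)).indicator (fun u => ‖fracKernel d u‖ₑ) u < ∞ := by
  have hi : IntegrableOn (fun u : ℝ => u ^ (d - 1)) (Set.Ioc 0 1) volume :=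
    (intervalIntegrable_iff_integrableOn_Ioc_of_le zero_le_one).1
      (intervalIntegral.intervalIntegrable_rpow' (by linarith))
  have h := hi.2
  rw [HasFiniteIntegral, ← lintegral_indicator measurableSet_Ioc] at h
  refine lt_of_le_of_lt (lintegral_mono fun u => ?_) h
  by_cases h0 : 0 < u <;> by_cases h1 : u ≤ 1 <;>
    simp [fracKernel, Set.indicator, h0, h1]

lemma lintegral_fracKernel_Ioi_rpow_lt_top {d α : ℝ} (hα : 0 < α) (hdα : d < 1 - 1 / α) :
    ∫⁻ u, (Set.Ioi (1 : ℝ)).indicator (fun u => ‖fracKernel d u‖ₑ) u ^ α < ∞ := by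
  have hlt : (d - 1) * α < -1 := by
    have h1 : d - 1 < -(1 / α) := by linarith
    have h2 := mul_lt_mul_of_pos_right h1 hα
    rwa [neg_mul, one_div_mul_cancel hα.ne'] at h2
  have hi : IntegrableOn (fun u : ℝ => u ^ ((d - 1) * α)) (Set.Ioi 1) volume :=
    integrableOn_Ioi_rpow_of_lt hlt zero_lt_one
  have h := hi.2
  rw [HasFiniteIntegral, ← lintegral_indicator measurableSet_Ioi] at h
  refine lt_of_le_of_lt (lintegral_mono fun u => ?_) h
  by_cases h1 : 1 < u
  · have h0 : 0 < u := by linarith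
    simp only [fracKernel, Set.indicator, Set.mem_Ioi, h0, h1, if_true]
    rw [Real.enorm_eq_ofReal_abs, Real.enorm_eq_ofReal_abs,
      ENNReal.ofReal_rpow_of_nonneg (abs_nonneg _) hα.le,
      abs_of_nonneg (Real.rpow_nonneg h0.le _), abs_of_nonneg (Real.rpow_nonneg h0.le _),
      ← Real.rpow_mul h0.le]
  · simp [Set.indicator, h1, hα]

/-- The fractional integral is bounded from `L^1 ∩ L^α` to `L^α`. -/
lemma exists_eLpNorm_fracIntegralRight_le {d α : ℝ} (hα : 1 ≤ α) (hd : 0 < d)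
    (hdα : d < 1 - 1 / α) :
    ∃ C : ℝ≥0∞, C ≠ ∞ ∧ ∀ f : ℝ → ℝ, AEStronglyMeasurable f volume →
      eLpNorm (fracIntegralRight d f) (ENNReal.ofReal α) volume
        ≤ C * (eLpNorm f 1 volume + eLpNorm f (ENNReal.ofReal α) volume) := by
  have hα0 : 0 < α := by linarith
  set K : ℝ → ℝ≥0∞ := fun u => ‖fracKernel d u‖ₑ with hK
  have hKm : Measurable K := (measurable_fracKernel d).enorm
  set K₁ := (Set.Iic (1 : ℝ)).indicator K with hK₁
  set K₂ := (Set.Ioi (1 : ℝ)).indicator K with hK₂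
  have hK₁m : Measurable K₁ := hKm.indicator measurableSet_Iic
  have hK₂m : Measurable K₂ := hKm.indicator measurableSet_Ioi
  have hKsum : ∀ u, K u = K₁ u + K₂ u := by
    intro u
    rw [hK₁, hK₂, ← Set.compl_Iic, Set.indicator_self_add_compl_apply]
  set A := ∫⁻ u, K₁ u with hA
  set B := (∫⁻ u, K₂ u ^ α) ^ (1 / α) with hB
  have hAtop : A ≠ ∞ := (lintegral_fracKernel_Iic_lt_top hd).ne
  have hBtop : B ≠ ∞ := ENNReal.rpow_ne_top_of_nonneg (by positivity)
    (lintegral_fracKernel_Ioi_rpow_lt_top hα0 hdα).ne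
  refine ⟨‖(Real.Gamma d)⁻¹‖ₑ * (A + B), ENNReal.mul_ne_top (by simp)
    (ENNReal.add_ne_top.2 ⟨hAtop, hBtop⟩), fun f hf => ?_⟩
  -- Both sides depend only on the almost everywhere class of `f`.
  wlog hfm : Measurable f generalizing f
  · have := this (hf.mk f) hf.stronglyMeasurable_mk.aestronglyMeasurable
      hf.stronglyMeasurable_mk.measurable
    rwa [← fracIntegralRight_congr_ae hf.ae_eq_mk, ← eLpNorm_congr_ae hf.ae_eq_mk,
      ← eLpNorm_congr_ae hf.ae_eq_mk] at this
  set F : ℝ → ℝ≥0∞ := fun t => ‖f t‖ₑ with hF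
  have hFm : Measurable F := hfm.enorm
  have hmeas : ∀ k : ℝ → ℝ≥0∞, Measurable k → Measurable fun x => ∫⁻ t, F t * k (t - x) :=
    fun k hk => Measurable.lintegral_prod_right' (f := fun z : ℝ × ℝ => F z.2 * k (z.2 - z.1))
      ((hFm.comp measurable_snd).mul (hk.comp (measurable_snd.sub measurable_fst)))
  have hpt : ∀ x, ‖fracIntegralRight d f x‖ₑ ≤ ‖(Real.Gamma d)⁻¹‖ₑ *
      ((∫⁻ t, F t * K₁ (t - x)) + ∫⁻ t, F t * K₂ (t - x)) := by
    intro x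
    have hm : Measurable fun t => F t * K₁ (t - x) :=
      hFm.mul (hK₁m.comp (measurable_id.sub_const x))
    rw [fracIntegralRight_eq_integral, enorm_mul, ← lintegral_add_left hm]
    gcongr
    refine (enorm_integral_le_lintegral_enorm _).trans_eq (lintegral_congr fun t => ?_)
    rw [enorm_mul, ← mul_add, ← hKsum]
  have hone : eLpNorm f 1 volume = ∫⁻ t, F t := eLpNorm_one_eq_lintegral_enorm
  have hal : eLpNorm f (ENNReal.ofReal α) volume = (∫⁻ t, F t ^ α) ^ (1 / α) := by
    rw [eLpNorm_eq_lintegral_rpow_enorm_toReal (by simpa) (by simp), ENNReal.toReal_ofReal hα0.le]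
  have hb1 : (∫⁻ x, (∫⁻ t, F t * K₁ (t - x)) ^ α) ^ (1 / α)
      ≤ A * eLpNorm f (ENNReal.ofReal α) volume := by
    refine (ENNReal.rpow_le_rpow (lintegral_conv_rpow_le_left hα hFm hK₁m)
      (by positivity)).trans_eq ?_
    rw [ENNReal.mul_rpow_of_nonneg _ _ (by positivity), ← ENNReal.rpow_mul,
      mul_one_div_cancel hα0.ne', ENNReal.rpow_one, hal]
  have hb2 : (∫⁻ x, (∫⁻ t, F t * K₂ (t - x)) ^ α) ^ (1 / α) ≤ B * eLpNorm f 1 volume := by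
    refine (ENNReal.rpow_le_rpow (lintegral_conv_rpow_le_right hα hFm hK₂m)
      (by positivity)).trans_eq ?_
    rw [ENNReal.mul_rpow_of_nonneg _ _ (by positivity), ← ENNReal.rpow_mul,
      mul_one_div_cancel hα0.ne', ENNReal.rpow_one, hone, mul_comm]
  rw [eLpNorm_eq_lintegral_rpow_enorm_toReal (by simpa) (by simp), ENNReal.toReal_ofReal hα0.le]
  calc (∫⁻ x, ‖fracIntegralRight d f x‖ₑ ^ α) ^ (1 / α)
      ≤ (∫⁻ x, (‖(Real.Gamma d)⁻¹‖ₑ *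
          ((∫⁻ t, F t * K₁ (t - x)) + ∫⁻ t, F t * K₂ (t - x))) ^ α) ^ (1 / α) := by
        gcongr with x
        exact hpt x
    _ = ‖(Real.Gamma d)⁻¹‖ₑ * (∫⁻ x,
          ((∫⁻ t, F t * K₁ (t - x)) + ∫⁻ t, F t * K₂ (t - x)) ^ α) ^ (1 / α) := by
        simp only [ENNReal.mul_rpow_of_nonneg _ _ hα0.le]
        rw [lintegral_const_mul' _ _ (ENNReal.rpow_ne_top_of_nonneg hα0.le (by simp)),
          ENNReal.mul_rpow_of_nonneg _ _ (by positivity), ← ENNReal.rpow_mul,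
          mul_one_div_cancel hα0.ne', ENNReal.rpow_one]
    _ ≤ ‖(Real.Gamma d)⁻¹‖ₑ * (A * eLpNorm f (ENNReal.ofReal α) volume
          + B * eLpNorm f 1 volume) := by
        gcongr
        exact (ENNReal.lintegral_Lp_add_le (hmeas _ hK₁m).aemeasurable
          (hmeas _ hK₂m).aemeasurable hα).trans (add_le_add hb1 hb2)
    _ ≤ _ := by
        rw [mul_assoc]
        gcongr
        rw [add_mul, mul_add, mul_add]
        calc _ ≤ (A * eLpNorm f (ENNReal.ofReal α) volume + B * eLpNorm f 1 volume)
              + (A * eLpNorm f 1 volume + B * eLpNorm f (ENNReal.ofReal α) volume) :=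
              le_self_add
          _ = _ := by ring

lemma memLp_fracIntegralRight {d α : ℝ} (hα : 1 ≤ α) (hd : 0 < d) (hdα : d < 1 - 1 / α)
    {f : ℝ → ℝ} (h1 : MemLp f 1 volume) (h2 : MemLp f (ENNReal.ofReal α) volume) :
    MemLp (fracIntegralRight d f) (ENNReal.ofReal α) volume := by
  obtain ⟨C, hC, hle⟩ := exists_eLpNorm_fracIntegralRight_le hα hd hdα
  refine ⟨aestronglyMeasurable_fracIntegralRight h1.1, (hle f h1.1).trans_lt ?_⟩
  exact ENNReal.mul_lt_top hC.lt_top (ENNReal.add_lt_top.2 ⟨h1.2, h2.2⟩)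

/-- The fractional integral of a bounded integrable function converges at every point. -/
lemma integrable_mul_fracKernel {d : ℝ} (hd : 0 < d) (hd1 : d ≤ 1) {f : ℝ → ℝ}
    (hf : Integrable f volume) {B : ℝ} (hB : ∀ t, |f t| ≤ B) (x : ℝ) :
    Integrable (fun t => f t * fracKernel d (t - x)) volume := by
  have hKx : Measurable fun t => fracKernel d (t - x) :=
    (measurable_fracKernel d).comp (measurable_id.sub_const x)
  refine ⟨hf.1.mul hKx.aestronglyMeasurable, ?_⟩
  -- Within distance `1` the bound `B` on `f` meets an integrable kernel; farther out the kernel is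
  -- at most `1` because `d ≤ 1`, and `f` is integrable.
  have hbound : ∀ t, ‖f t * fracKernel d (t - x)‖ₑ ≤ ‖f t‖ₑ + ENNReal.ofReal B *
      (Set.Iic (1 : ℝ)).indicator (fun u => ‖fracKernel d u‖ₑ) (t - x) := by
    intro t
    rw [enorm_mul]
    by_cases h : t - x ≤ 1
    · rw [Set.indicator_of_mem (show t - x ∈ Set.Iic (1 : ℝ) from h)]
      refine le_trans ?_ le_add_self
      gcongr
      rw [Real.enorm_eq_ofReal_abs]
      exact ENNReal.ofReal_le_ofReal (hB t)
    · refine le_trans ?_ le_self_add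
      refine mul_le_of_le_one_right' ?_
      rw [not_le] at h
      rw [fracKernel, Set.indicator_of_mem (show t - x ∈ Set.Ioi (0 : ℝ) from by
        simp only [Set.mem_Ioi]; linarith), Real.enorm_eq_ofReal_abs, ENNReal.ofReal_le_one,
        abs_of_nonneg (Real.rpow_nonneg (by linarith) _)]
      exact Real.rpow_le_one_of_one_le_of_nonpos h.le (by linarith)
  refine lt_of_le_of_lt (lintegral_mono hbound) ?_
  rw [lintegral_add_left' hf.1.enorm, lintegral_const_mul' _ _ ENNReal.ofReal_ne_top,
    lintegral_sub_right_eq_self (fun u =>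
      (Set.Iic (1 : ℝ)).indicator (fun u => ‖fracKernel d u‖ₑ) u) x]
  exact ENNReal.add_lt_top.2 ⟨hf.2,
    ENNReal.mul_lt_top ENNReal.ofReal_lt_top (lintegral_fracKernel_Iic_lt_top hd)⟩

lemma fracIntegralRight_sub {d : ℝ} {f g : ℝ → ℝ} {x : ℝ}
    (hf : Integrable (fun t => f t * fracKernel d (t - x)) volume)
    (hg : Integrable (fun t => g t * fracKernel d (t - x)) volume) :
    fracIntegralRight d (fun t => f t - g t) x
      = fracIntegralRight d f x - fracIntegralRight d g x := by
  simp only [fracIntegralRight_eq_integral, sub_mul]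
  rw [integral_sub hf hg, mul_sub]

/-- The fractional integral of the indicator of an interval. -/
lemma integral_Ioc_indicator_mul_fracKernel {d : ℝ} (hd : 0 < d) {s t : ℝ} (hst : s ≤ t) (a x : ℝ) :
    (Real.Gamma d)⁻¹ * ∫ u, (Set.Ioc s t).indicator (fun _ => a) u * fracKernel d (u - x)
      = a * ((Real.Gamma (d + 1))⁻¹ * (max (t - x) 0) ^ d
        - (Real.Gamma (d + 1))⁻¹ * (max (s - x) 0) ^ d) := by
  -- Cutting at `x` replaces both endpoints by their maximum with `x`; this covers all positions of
  -- `x`, the interval being empty when `t ≤ x`.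
  have h1 : ∀ u, (Set.Ioc s t).indicator (fun _ => a) u * fracKernel d (u - x)
      = (Set.Ioc (max s x) (max t x)).indicator (fun u => a * (u - x) ^ (d - 1)) u := by
    intro u
    by_cases hs : s < u <;> by_cases ht : u ≤ t <;> by_cases hx : x < u <;>
      simp [fracKernel, Set.indicator, hs, ht, hx]
  simp only [h1]
  have hle : max s x ≤ max t x := max_le_max_right _ hst
  rw [integral_indicator measurableSet_Ioc, ← intervalIntegral.integral_of_le hle,
    intervalIntegral.integral_const_mul,
    intervalIntegral.integral_comp_sub_right (fun u => u ^ (d - 1)) x,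
    integral_rpow (Or.inl (by linarith)), Real.Gamma_add_one hd.ne']
  have h2 : ∀ r, max r x - x = max (r - x) 0 := by
    intro r; rw [← max_sub_sub_right, sub_self]
  rw [h2, h2, sub_add_cancel]
  have := (Real.Gamma_pos_of_pos hd).ne'
  field_simp

/-- The bridge between `M` and `I_-^d`: the path on the right is the kernel of `M t`, whose term
`(-x)_+^d` cancels in every increment. -/
lemma fracIntegralRight_toFun {d : ℝ} (hd : 0 < d) (hd1 : d ≤ 1) (φ : StepFun) (x : ℝ) :
    fracIntegralRight d φ.toFun x
      = φ.incr fun t => (Real.Gamma (d + 1))⁻¹ * ((max (t - x) 0) ^ d - (max (-x) 0) ^ d) := by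
  rw [fracIntegralRight_eq_integral]
  unfold StepFun.toFun
  simp only [Finset.sum_mul]
  rw [integral_finsetSum, Finset.mul_sum]
  · refine Finset.sum_congr rfl fun i _ => ?_
    rw [integral_Ioc_indicator_mul_fracKernel hd (φ.strictMono Fin.castSucc_lt_succ).le]
    ring
  · intro i _
    refine integrable_mul_fracKernel hd hd1 (B := |φ.a i|) ?_ (fun t => ?_) x
    · rw [integrable_indicator_iff measurableSet_Ioc]
      exact integrableOn_const (by simp)
    · by_cases ht : t ∈ Set.Ioc (φ.t i.castSucc) (φ.t i.succ)
      · rw [Set.indicator_of_mem ht]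
      · rw [Set.indicator_of_notMem ht]; simp

/-- A simple function is bounded. -/
lemma StepFun.exists_abs_toFun_le (φ : StepFun) : ∃ B, ∀ x, |φ.toFun x| ≤ B := by
  refine ⟨∑ i : Fin φ.n, |φ.a i|, fun x => (Finset.abs_sum_le_sum_abs _ _).trans ?_⟩
  refine Finset.sum_le_sum fun i _ => ?_
  by_cases hx : x ∈ Set.Ioc (φ.t i.castSucc) (φ.t i.succ)
  · rw [Set.indicator_of_mem hx]
  · rw [Set.indicator_of_notMem hx]; simp

lemma StepFun.integrable_mul_fracKernel {d : ℝ} (hd : 0 < d) (hd1 : d ≤ 1) (φ : StepFun) (x : ℝ) :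
    Integrable (fun t => φ.toFun t * fracKernel d (t - x)) volume := by
  obtain ⟨B, hB⟩ := φ.exists_abs_toFun_le
  exact _root_.integrable_mul_fracKernel hd hd1 (memLp_one_iff_integrable.1 (φ.memLp_toFun 1)) hB x

end Young

/-! ### The stable integral as a bounded map from `L^α(ℝ)` to `L^p(Ω)` -/

section StableLimit

/-- `X` is the `L^p`-limit of the integrals of simple functions converging to `f` in `L^α`. -/
structure IsStableLimit {Ω : Type*} [MeasurableSpace Ω] (P : Measure Ω) (α p : ℝ)
    (L : ℝ → Ω → ℝ) (f : ℝ → ℝ) (X : Ω → ℝ) : Prop where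
  memLp_left : MemLp f (ENNReal.ofReal α) volume
  memLp_right : MemLp X (ENNReal.ofReal p) P
  exists_approx : ∃ φ : ℕ → StepFun,
    Tendsto (fun k => eLpNorm (fun x => (φ k).toFun x - f x) (ENNReal.ofReal α) volume)
      atTop (𝓝 0) ∧
    Tendsto (fun k => eLpNorm (fun ω => (φ k).integral L ω - X ω) (ENNReal.ofReal p) P)
      atTop (𝓝 0)

lemma tendsto_eLpNorm_lin {β : Type*} [MeasurableSpace β] {μ : Measure β} {q : ℝ≥0∞} (hq : 1 ≤ q)
    {u v w : ℕ → β → ℝ} {f g : β → ℝ} (r : ℝ)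
    (hu : ∀ k, AEStronglyMeasurable (u k) μ) (hv : ∀ k, AEStronglyMeasurable (v k) μ)
    (hf : AEStronglyMeasurable f μ) (hg : AEStronglyMeasurable g μ)
    (hw : ∀ k x, w k x = u k x + r * v k x)
    (h1 : Tendsto (fun k => eLpNorm (fun x => u k x - f x) q μ) atTop (𝓝 0))
    (h2 : Tendsto (fun k => eLpNorm (fun x => v k x - g x) q μ) atTop (𝓝 0)) :
    Tendsto (fun k => eLpNorm (fun x => w k x - (f x + r * g x)) q μ) atTop (𝓝 0) := by
  have hlim := h1.add (ENNReal.Tendsto.const_mul (a := ‖r‖ₑ) h2 (Or.inr (by simp)))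
  rw [mul_zero, add_zero] at hlim
  refine tendsto_of_tendsto_of_tendsto_of_le_of_le tendsto_const_nhds hlim
    (fun _ => zero_le) fun k => ?_
  have he : (fun x => w k x - (f x + r * g x))
      = (fun x => u k x - f x) + r • (fun x => v k x - g x) := by
    ext x; simp only [hw, Pi.add_apply, Pi.smul_apply, smul_eq_mul]; ring
  dsimp only
  rw [he, ← eLpNorm_const_smul r (fun x => v k x - g x)]
  exact eLpNorm_add_le ((hu k).sub hf) (((hv k).sub hg).const_smul r) hq

variable {Ω : Type*} [MeasurableSpace Ω] {P : Measure Ω} {α p : ℝ} {L : ℝ → Ω → ℝ}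

lemma IsSymmStableMotion.isStableLimit_stepFun [IsProbabilityMeasure P]
    (hL : IsSymmStableMotion P α L) (hp : 0 < p) (hpα : p < α) (φ : StepFun) :
    IsStableLimit P α p L φ.toFun (φ.integral L) := by
  refine ⟨φ.memLp_toFun _, ⟨(φ.measurable_integral hL.measurable).aestronglyMeasurable, ?_⟩,
    fun _ => φ, by simp, by simp⟩
  rw [hL.eLpNorm_integral (hp.trans hpα)]
  exact ENNReal.mul_lt_top (hL.memLp_one hp hpα).2 (φ.memLp_toFun _).2

/-- The combined simple functions `χ k` come from `exists_add_mul`, so the same sequence serves the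
kernels on `ℝ` and the integrals on `Ω`. -/
lemma IsStableLimit.add_mul (hL : ∀ t, Measurable (L t)) (hp : 1 ≤ p) (hα : 1 ≤ α)
    {f g : ℝ → ℝ} {X Y : Ω → ℝ} (hf : IsStableLimit P α p L f X) (hg : IsStableLimit P α p L g Y)
    (r : ℝ) : IsStableLimit P α p L (fun x => f x + r * g x) (fun ω => X ω + r * Y ω) := by
  obtain ⟨φ, hφ1, hφ2⟩ := hf.exists_approx
  obtain ⟨ψ, hψ1, hψ2⟩ := hg.exists_approx
  choose χ hχ using fun k => (φ k).exists_add_mul (ψ k) r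
  refine ⟨hf.memLp_left.add (hg.memLp_left.const_mul r),
    hf.memLp_right.add (hg.memLp_right.const_mul r), χ, ?_, ?_⟩
  · refine tendsto_eLpNorm_lin (by simpa) r (fun k => ((φ k).memLp_toFun 1).1)
      (fun k => ((ψ k).memLp_toFun 1).1) hf.memLp_left.1 hg.memLp_left.1 (fun k x => ?_) hφ1 hψ1
    simp only [StepFun.toFun_eq_incr, hχ]
  · refine tendsto_eLpNorm_lin (by simpa) r
      (fun k => ((φ k).measurable_integral hL).aestronglyMeasurable)
      (fun k => ((ψ k).measurable_integral hL).aestronglyMeasurable)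
      hf.memLp_right.1 hg.memLp_right.1 (fun k x => ?_) hφ2 hψ2
    simp only [StepFun.integral_eq_incr, hχ]

lemma IsStableLimit.congr {f g : ℝ → ℝ} {X Y : Ω → ℝ} (h : IsStableLimit P α p L f X)
    (hfg : f = g) (hXY : X =ᵐ[P] Y) : IsStableLimit P α p L g Y := by
  subst hfg
  obtain ⟨φ, hφ1, hφ2⟩ := h.exists_approx
  refine ⟨h.memLp_left, h.memLp_right.ae_eq hXY, φ, hφ1, ?_⟩
  refine hφ2.congr fun k => eLpNorm_congr_ae ?_
  filter_upwards [hXY] with ω hω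
  rw [hω]

lemma eLpNorm_le_add_of_sub {β : Type*} [MeasurableSpace β] {μ : Measure β} {q : ℝ≥0∞} (hq : 1 ≤ q)
    {u f : β → ℝ} (hu : AEStronglyMeasurable u μ) (hf : AEStronglyMeasurable f μ) :
    eLpNorm u q μ ≤ eLpNorm (fun x => u x - f x) q μ + eLpNorm f q μ := by
  have h : u = (fun x => u x - f x) + f := by ext x; simp
  conv_lhs => rw [h]
  exact eLpNorm_add_le (hu.sub hf) hf hq

/-- The stable integral is bounded from `L^α(ℝ)` to `L^p(Ω)`. -/
lemma IsStableLimit.eLpNorm_le [IsProbabilityMeasure P] (hL : IsSymmStableMotion P α L)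
    (hp : 1 ≤ p) (hα : 1 ≤ α) {c : ℝ≥0∞} (hc : eLpNorm (L 1) (ENNReal.ofReal p) P = c)
    (hctop : c ≠ ∞) {f : ℝ → ℝ} {X : Ω → ℝ} (h : IsStableLimit P α p L f X) :
    eLpNorm X (ENNReal.ofReal p) P ≤ c * eLpNorm f (ENNReal.ofReal α) volume := by
  obtain ⟨φ, hφ1, hφ2⟩ := h.exists_approx
  have hp1 : 1 ≤ ENNReal.ofReal p := by simpa
  have hα1 : 1 ≤ ENNReal.ofReal α := by simpa
  have hlim : Tendsto (fun k =>
      eLpNorm (fun ω => (φ k).integral L ω - X ω) (ENNReal.ofReal p) P +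
        c * (eLpNorm (fun x => (φ k).toFun x - f x) (ENNReal.ofReal α) volume
          + eLpNorm f (ENNReal.ofReal α) volume)) atTop
      (𝓝 (0 + c * (0 + eLpNorm f (ENNReal.ofReal α) volume))) :=
    hφ2.add (ENNReal.Tendsto.const_mul (hφ1.add_const _) (Or.inr hctop))
  rw [zero_add, zero_add] at hlim
  refine ge_of_tendsto' hlim fun k => ?_
  have hmeas := ((φ k).measurable_integral hL.measurable).aestronglyMeasurable (μ := P)
  calc eLpNorm X (ENNReal.ofReal p) P
      ≤ eLpNorm (fun ω => X ω - (φ k).integral L ω) (ENNReal.ofReal p) P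
        + eLpNorm ((φ k).integral L) (ENNReal.ofReal p) P :=
        eLpNorm_le_add_of_sub hp1 h.memLp_right.1 hmeas
    _ = eLpNorm (fun ω => (φ k).integral L ω - X ω) (ENNReal.ofReal p) P
        + c * eLpNorm (φ k).toFun (ENNReal.ofReal α) volume := by
        rw [hL.eLpNorm_integral (by linarith), hc]
        congr 1
        exact eLpNorm_sub_comm X ((φ k).integral L) _ _
    _ ≤ _ := by
        gcongr
        exact eLpNorm_le_add_of_sub hα1 ((φ k).memLp_toFun 1).1 h.memLp_left.1

lemma IsStableLimit.eLpNorm_sub_le [IsProbabilityMeasure P] (hL : IsSymmStableMotion P α L)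
    (hp : 1 ≤ p) (hpα : p < α) {f g : ℝ → ℝ} {X Y : Ω → ℝ}
    (hf : IsStableLimit P α p L f X) (hg : IsStableLimit P α p L g Y) :
    eLpNorm (fun ω => X ω - Y ω) (ENNReal.ofReal p) P ≤ eLpNorm (L 1) (ENNReal.ofReal p) P *
      eLpNorm (fun x => f x - g x) (ENNReal.ofReal α) volume := by
  have h := (hf.add_mul hL.measurable hp (by linarith) hg (-1)).eLpNorm_le hL hp (by linarith) rfl
    (hL.memLp_one (by linarith) hpα).2.ne
  simpa only [neg_mul, one_mul, ← sub_eq_add_neg] using h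

/-- Every function in `L^α(ℝ)` has a stable integral. -/
lemma IsSymmStableMotion.exists_isStableLimit [IsProbabilityMeasure P]
    (hL : IsSymmStableMotion P α L) (hp : 1 ≤ p) (hpα : p < α) {f : ℝ → ℝ}
    (hf : MemLp f (ENNReal.ofReal α) volume) : ∃ X, IsStableLimit P α p L f X := by
  have hp1 : 1 ≤ ENNReal.ofReal p := by simpa
  have hα1 : 1 ≤ ENNReal.ofReal α := by simp; linarith
  have : Fact (1 ≤ ENNReal.ofReal p) := ⟨hp1⟩
  obtain ⟨φ, hφ⟩ := StepFun.exists_tendsto_eLpNorm hα1 (by simp) hf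
  have hstep := fun k => hL.isStableLimit_stepFun (p := p) (by linarith) hpα (φ k)
  set c := eLpNorm (L 1) (ENNReal.ofReal p) P with hc
  have hctop : c ≠ ∞ := (hL.memLp_one (by linarith) hpα).2.ne
  set u : ℕ → Lp ℝ (ENNReal.ofReal p) P := fun k => (hstep k).memLp_right.toLp _ with hu
  -- The integrals inherit the Cauchy property of `φ` in `L^α`, up to the factor `c`.
  have hcau : CauchySeq u := by
    rw [EMetric.cauchySeq_iff]
    intro ε hε
    have hlim := ENNReal.Tendsto.const_mul (a := c) hφ (Or.inr hctop)
    rw [mul_zero] at hlim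
    obtain ⟨N, hN⟩ := eventually_atTop.1
      (hlim.eventually (gt_mem_nhds (ENNReal.half_pos hε.ne')))
    refine ⟨N, fun m hm n hn => ?_⟩
    rw [hu, Lp.edist_toLp_toLp]
    refine lt_of_le_of_lt ((hstep m).eLpNorm_sub_le hL hp hpα (hstep n)) ?_
    have htri : eLpNorm (fun x => (φ m).toFun x - (φ n).toFun x) (ENNReal.ofReal α) volume
        ≤ eLpNorm (fun x => (φ m).toFun x - f x) (ENNReal.ofReal α) volume
          + eLpNorm (fun x => (φ n).toFun x - f x) (ENNReal.ofReal α) volume := by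
      have he : (fun x => (φ m).toFun x - (φ n).toFun x)
          = (fun x => (φ m).toFun x - f x) - (fun x => (φ n).toFun x - f x) := by
        ext x; simp
      rw [he]
      exact MeasureTheory.eLpNorm_sub_le (((φ m).memLp_toFun _).sub hf).1
        (((φ n).memLp_toFun _).sub hf).1 hα1
    calc _ ≤ c * _ := mul_le_mul_right htri c
      _ < ε / 2 + ε / 2 := by rw [mul_add]; exact ENNReal.add_lt_add (hN m hm) (hN n hn)
      _ = ε := ENNReal.add_halves ε
  obtain ⟨X, hX⟩ := cauchySeq_tendsto_of_complete hcau
  refine ⟨X, hf, Lp.memLp X, φ, hφ, ?_⟩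
  rw [Lp.tendsto_Lp_iff_tendsto_eLpNorm'] at hX
  refine hX.congr fun k => eLpNorm_congr_ae ?_
  filter_upwards [(hstep k).memLp_right.coeFn_toLp] with ω hω
  simp only [hu, Pi.sub_apply, hω]

/-- For any approximating sequence the integrals converge in `L^p`. -/
lemma IsStableLimit.tendsto [IsProbabilityMeasure P] (hL : IsSymmStableMotion P α L)
    (hp : 1 ≤ p) (hpα : p < α) {f : ℝ → ℝ} {X : Ω → ℝ} (hf : IsStableLimit P α p L f X)
    {g : ℕ → ℝ → ℝ} {Z : ℕ → Ω → ℝ} (hg : ∀ k, IsStableLimit P α p L (g k) (Z k))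
    (h : Tendsto (fun k => eLpNorm (fun x => g k x - f x) (ENNReal.ofReal α) volume)
      atTop (𝓝 0)) :
    Tendsto (fun k => eLpNorm (fun ω => Z k ω - X ω) (ENNReal.ofReal p) P) atTop (𝓝 0) := by
  have hlim := ENNReal.Tendsto.const_mul (a := eLpNorm (L 1) (ENNReal.ofReal p) P) h
    (Or.inr (hL.memLp_one (by linarith) hpα).2.ne)
  rw [mul_zero] at hlim
  exact tendsto_of_tendsto_of_tendsto_of_le_of_le tendsto_const_nhds hlim
    (fun _ => zero_le) fun k => (hg k).eLpNorm_sub_le hL hp hpα hf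

lemma IsStableLimit.hasStableIntegral [IsProbabilityMeasure P] (hL : IsSymmStableMotion P α L)
    (hp : 1 ≤ p) (hpα : p < α) {f : ℝ → ℝ} {X : Ω → ℝ} (hf : IsStableLimit P α p L f X) :
    HasStableIntegral P α L f X := by
  refine ⟨hf.memLp_left, hf.memLp_right.1, ?_, fun φ hφ => ?_⟩
  · obtain ⟨φ, hφ, -⟩ := hf.exists_approx
    exact ⟨φ, hφ⟩
  · have hstep := fun k => hL.isStableLimit_stepFun (p := p) (by linarith) hpα (φ k)
    exact tendstoInMeasure_of_tendsto_eLpNorm (by simp; linarith)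
      (fun k => (hstep k).memLp_right.1) hf.memLp_right.1 (hf.tendsto hL hp hpα hstep hφ)

/-- The limit in probability is also the limit in `L^p`. -/
lemma HasStableIntegral.isStableLimit [IsProbabilityMeasure P] (hL : IsSymmStableMotion P α L)
    (hp : 1 ≤ p) (hpα : p < α) {f : ℝ → ℝ} {X : Ω → ℝ} (hf : HasStableIntegral P α L f X) :
    IsStableLimit P α p L f X := by
  -- The `L^p` limit `X'` and `X` are limits in probability along one sequence, hence equal almost
  -- surely.
  obtain ⟨X', hX'⟩ := hL.exists_isStableLimit hp hpα hf.memLp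
  obtain ⟨φ, hφ⟩ := hf.exists_approx
  exact hX'.congr rfl (tendstoInMeasure_ae_unique
    ((hX'.hasStableIntegral hL hp hpα).tendsto φ hφ) (hf.tendsto φ hφ))

end StableLimit

/-! ### Integration against linear fractional stable motion -/

section FractionalMotion

/-- The kernel of linear fractional stable motion. -/
noncomputable def lfsmKernel (d t x : ℝ) : ℝ :=
  (Real.Gamma (d + 1))⁻¹ * ((max (t - x) 0) ^ d - (max (-x) 0) ^ d)

lemma lfsmKernel_zero (d x : ℝ) : lfsmKernel d 0 x = 0 := by simp [lfsmKernel]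

/-- The signed indicator of the interval between `0` and `t`: knots must increase, so for `t < 0`
the coefficient is `-1`. It exhibits the kernel of `M t` as a fractional integral, hence as an
element of `L^α`. -/
lemma StepFun.exists_incr_eq_sub {t : ℝ} (ht : t ≠ 0) :
    ∃ φ : StepFun, ∀ c : ℝ → ℝ, φ.incr c = c t - c 0 := by
  rcases lt_or_gt_of_ne ht with h | h
  · refine ⟨⟨1, ![t, 0], ![-1], ?_⟩, fun c => ?_⟩
    · rw [Fin.strictMono_iff_lt_succ]; intro i; fin_cases i; simpa using h
    · simp [StepFun.incr]
  · refine ⟨⟨1, ![0, t], ![1], ?_⟩, fun c => ?_⟩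
    · rw [Fin.strictMono_iff_lt_succ]; intro i; fin_cases i; simpa using h
    · simp [StepFun.incr]

lemma memLp_lfsmKernel {d α : ℝ} (hα : 1 ≤ α) (hd : 0 < d) (hdα : d < 1 - 1 / α) (t : ℝ) :
    MemLp (lfsmKernel d t) (ENNReal.ofReal α) volume := by
  rcases eq_or_ne t 0 with rfl | ht
  · have : lfsmKernel d 0 = 0 := funext fun x => lfsmKernel_zero d x
    rw [this]; exact MemLp.zero
  · obtain ⟨φ, hφ⟩ := StepFun.exists_incr_eq_sub ht
    have hd1 : d ≤ 1 := by
      have : 0 < 1 / α := by positivity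
      linarith
    have h : lfsmKernel d t = fracIntegralRight d φ.toFun := by
      ext x
      rw [fracIntegralRight_toFun hd hd1, hφ]
      exact (sub_eq_self.2 (lfsmKernel_zero d x)).symm
    rw [h]
    exact memLp_fracIntegralRight hα hd hdα (φ.memLp_toFun _) (φ.memLp_toFun _)

lemma memLp_ofReal_of_bound {f : ℝ → ℝ} {B α : ℝ} (hα : 1 ≤ α) (hf : MemLp f 1 volume)
    (hB : ∀ x, |f x| ≤ B) : MemLp f (ENNReal.ofReal α) volume := by
  refine ⟨hf.1, (eLpNorm_le_of_bound_of_one_le hα hB).trans_lt ?_⟩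
  refine ENNReal.rpow_lt_top_of_nonneg (by positivity) (ENNReal.mul_ne_top ?_ hf.2.ne)
  exact ENNReal.rpow_ne_top_of_nonneg (by linarith) ENNReal.ofReal_ne_top

lemma integrable_of_exp_bound {g : ℝ → ℝ} (hg : AEMeasurable g volume)
    (h0 : ∀ t : ℝ, t < 0 → g t = 0) {C c : ℝ} (hc : 0 < c)
    (hb : ∀ t : ℝ, |g t| ≤ C * Real.exp (-c * t)) : Integrable g volume := by
  have hi : Integrable ((Set.Ici (0 : ℝ)).indicator fun t => C * Real.exp (-c * t)) volume := by
    rw [integrable_indicator_iff measurableSet_Ici, integrableOn_Ici_iff_integrableOn_Ioi]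
    exact (exp_neg_integrableOn_Ioi 0 hc).const_mul C
  refine hi.mono' hg.aestronglyMeasurable (Eventually.of_forall fun t => ?_)
  by_cases ht : 0 ≤ t
  · rw [Set.indicator_of_mem (show t ∈ Set.Ici (0 : ℝ) from ht)]; exact hb t
  · rw [h0 t (not_le.1 ht), norm_zero, Set.indicator_of_notMem (by simpa using ht)]

lemma indicator_Iic_comp_sub {g : ℝ → ℝ} (h0 : ∀ t : ℝ, t < 0 → g t = 0) (t : ℝ) :
    ((Set.Iic t).indicator fun x => g (t - x)) = fun x => g (t - x) := by
  ext x
  by_cases hx : x ≤ t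
  · exact Set.indicator_of_mem (show x ∈ Set.Iic t from hx) _
  · rw [Set.indicator_of_notMem (by simpa using hx), h0 _ (by linarith [not_le.1 hx])]

/-- Reflection turns the right-sided fractional integral into the left-sided one. -/
lemma fracIntegralRight_comp_sub {g : ℝ → ℝ} (h0 : ∀ t : ℝ, t < 0 → g t = 0) (d t : ℝ) :
    fracIntegralRight d (fun x => g (t - x))
      = (Set.Iic t).indicator fun x => fracIntegralLeft d g (t - x) := by
  have hleft : ∀ y, fracIntegralLeft d g y
      = (Real.Gamma d)⁻¹ * ∫ s, g s * fracKernel d (y - s) := by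
    intro y
    rw [fracIntegralLeft, ← integral_indicator measurableSet_Iio]
    congr 2
    ext s
    by_cases hs : s < y <;> simp [fracKernel, Set.indicator, hs]
  have hmain : ∀ x, fracIntegralRight d (fun x => g (t - x)) x = fracIntegralLeft d g (t - x) := by
    intro x
    rw [hleft, fracIntegralRight_eq_integral,
      ← integral_sub_left_eq_self (fun s => g s * fracKernel d (t - x - s)) volume t]
    congr 2
    ext u
    congr 2; ring
  ext x
  rw [hmain]
  by_cases hx : x ≤ t
  · rw [Set.indicator_of_mem (show x ∈ Set.Iic t from hx)]
  · rw [Set.indicator_of_notMem (by simpa using hx), fracIntegralLeft,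
      setIntegral_eq_zero_of_forall_eq_zero, mul_zero]
    intro s hs
    rw [h0 s (lt_trans (Set.mem_Iio.1 hs) (by linarith [not_le.1 hx])), zero_mul]

variable {Ω : Type*} [MeasurableSpace Ω] {P : Measure Ω} {α p d : ℝ} {L M : ℝ → Ω → ℝ}

/-- Integrals of simple functions against a process of stable integrals are stable integrals. -/
lemma IsStableLimit.incr (hL : ∀ t, Measurable (L t)) (hp : 1 ≤ p) (hα : 1 ≤ α)
    {m : ℝ → ℝ → ℝ} (hM : ∀ t, IsStableLimit P α p L (m t) (M t)) (φ : StepFun) :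
    IsStableLimit P α p L (fun x => φ.incr fun t => m t x) (φ.integral M) := by
  have key : ∀ s : Finset (Fin φ.n), IsStableLimit P α p L
      (fun x => ∑ i ∈ s, φ.a i * (m (φ.t i.succ) x - m (φ.t i.castSucc) x))
      (fun ω => ∑ i ∈ s, φ.a i * (M (φ.t i.succ) ω - M (φ.t i.castSucc) ω)) := by
    intro s
    induction s using Finset.induction_on with
    | empty =>
      -- The zero pair is obtained as `M 0 - M 0`.
      have h := (hM 0).add_mul hL hp hα (hM 0) (-1)
      simpa using h
    | insert i s hi ih =>
      have h := (ih.add_mul hL hp hα (hM (φ.t i.succ)) (φ.a i)).add_mul hL hp hα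
        (hM (φ.t i.castSucc)) (-φ.a i)
      simp only [Finset.sum_insert hi]
      convert h using 2 <;> ring
  exact key Finset.univ

lemma tendsto_alphaPNorm_iff {u : ℕ → ℝ → ℝ} (h0 : eLpNorm (L 1) (ENNReal.ofReal p) P ≠ 0)
    (htop : eLpNorm (L 1) (ENNReal.ofReal p) P ≠ ∞) :
    Tendsto (fun k => alphaPNorm P α p d L (u k)) atTop (𝓝 0) ↔
      Tendsto (fun k => eLpNorm (fracIntegralRight d (u k)) (ENNReal.ofReal α) volume)
        atTop (𝓝 0) := by
  constructor
  · intro h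
    have h1 := ENNReal.Tendsto.const_mul (a := (eLpNorm (L 1) (ENNReal.ofReal p) P)⁻¹) h
      (Or.inr (ENNReal.inv_ne_top.2 h0))
    rw [mul_zero] at h1
    refine h1.congr fun k => ?_
    rw [alphaPNorm, ← mul_assoc, ENNReal.inv_mul_cancel h0 htop, one_mul]
  · intro h
    have h1 := ENNReal.Tendsto.const_mul (a := eLpNorm (L 1) (ENNReal.ofReal p) P) h
      (Or.inr htop)
    rwa [mul_zero] at h1

lemma HasLFSMIntegral.ae_eq (hp : 1 ≤ p) {h : ℝ → ℝ} {X Y : Ω → ℝ}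
    (hX : HasLFSMIntegral P α p d L M h X) (hY : HasLFSMIntegral P α p d L M h Y) :
    X =ᵐ[P] Y := by
  obtain ⟨φ, hφ⟩ := hX.exists_approx
  obtain ⟨hm, hX'⟩ := hX.tendsto φ hφ
  obtain ⟨-, hY'⟩ := hY.tendsto φ hφ
  have hp0 : ENNReal.ofReal p ≠ 0 := by simp; linarith
  exact tendstoInMeasure_ae_unique
    (tendstoInMeasure_of_tendsto_eLpNorm hp0 (fun k => (hm k).1) hX.memLp.1 hX')
    (tendstoInMeasure_of_tendsto_eLpNorm hp0 (fun k => (hm k).1) hY.memLp.1 hY')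

lemma HasLFSMIntegral.ae_eq_lfsmIntegral (hp : 1 ≤ p) {h : ℝ → ℝ} {X : Ω → ℝ}
    (hX : HasLFSMIntegral P α p d L M h X) : X =ᵐ[P] lfsmIntegral P α p d L M h := by
  have hex : ∃ X, HasLFSMIntegral P α p d L M h X := ⟨X, hX⟩
  rw [lfsmIntegral, dif_pos hex]
  exact hX.ae_eq hp hex.choose_spec

/-- The stable integral of `I_-^d h` is the integral of `h` against the linear fractional stable
motion. -/
lemma IsStableLimit.hasLFSMIntegral [IsProbabilityMeasure P] (hL : IsSymmStableMotion P α L)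
    (hp : 1 ≤ p) (hpα : p < α) (hd : 0 < d) (hdα : d < 1 - 1 / α)
    (hM : IsLinFracStableMotion P α d L M) {h : ℝ → ℝ} (hint : MemLp h 1 volume) {B : ℝ}
    (hB : ∀ x, |h x| ≤ B) {X : Ω → ℝ} (hX : IsStableLimit P α p L (fracIntegralRight d h) X) :
    HasLFSMIntegral P α p d L M h X := by
  have hα : 1 ≤ α := by linarith
  have hd1 : d ≤ 1 := by
    have : 0 < 1 / α := by positivity
    linarith
  have hLp := hL.memLp_one (p := p) (by linarith) hpα
  have hiff := fun u : ℕ → ℝ → ℝ => tendsto_alphaPNorm_iff (α := α) (d := d) (u := u)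
    (hL.eLpNorm_one_ne_zero (p := p) (by linarith)) hLp.2.ne
  have hMlim : ∀ t, IsStableLimit P α p L (lfsmKernel d t) (M t) := fun t =>
    (hM t).isStableLimit hL hp hpα
  have hφM : ∀ φ : StepFun,
      IsStableLimit P α p L (fracIntegralRight d φ.toFun) (φ.integral M) := by
    intro φ
    refine (IsStableLimit.incr hL.measurable hp hα hMlim φ).congr ?_ EventuallyEq.rfl
    ext x
    rw [fracIntegralRight_toFun hd hd1]
    rfl
  -- Boundedness of `h` makes both integrals converge at every `x`, so linearity holds pointwise and
  -- not just almost everywhere.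
  have hsub : ∀ φ : StepFun, fracIntegralRight d (fun x => φ.toFun x - h x)
      = fun x => fracIntegralRight d φ.toFun x - fracIntegralRight d h x := fun φ => funext fun x =>
    fracIntegralRight_sub (φ.integrable_mul_fracKernel hd hd1 x)
      (integrable_mul_fracKernel hd hd1 (memLp_one_iff_integrable.1 hint) hB x)
  refine ⟨hint, memLp_ofReal_of_bound hα hint hB, hX.memLp_right, ?_, fun φ hφ => ?_⟩
  · obtain ⟨φ, hφ1, hφα⟩ := StepFun.exists_tendsto_eLpNorm_one_and hint hα hB
    obtain ⟨C, hC, hle⟩ := exists_eLpNorm_fracIntegralRight_le hα hd hdα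
    refine ⟨φ, (hiff _).2 ?_⟩
    have hlim := ENNReal.Tendsto.const_mul (a := C) (hφ1.add hφα) (Or.inr hC)
    rw [add_zero, mul_zero] at hlim
    exact tendsto_of_tendsto_of_tendsto_of_le_of_le tendsto_const_nhds hlim
      (fun _ => zero_le) fun k => hle _ (((φ k).memLp_toFun 1).1.sub hint.1)
  · have hφ' := (hiff _).1 hφ
    simp only [hsub] at hφ'
    exact ⟨fun k => (hφM (φ k)).memLp_right, hX.tendsto hL hp hpα (fun k => hφM (φ k)) hφ'⟩

end FractionalMotion

/-! ### The main theorem -/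

theorem theorem4p2 {Ω : Type*} [MeasurableSpace Ω] (P : Measure Ω) [IsProbabilityMeasure P]
    (α p d : ℝ) (hα : 1 < α) (hα2 : α < 2) (hp : 1 < p) (hpα : p < α)
    (hd : 0 < d) (hdα : d < 1 - 1 / α)
    (L : ℝ → Ω → ℝ) (hL : IsSymmStableMotion P α L)
    (g : ℝ → ℝ) (hg : AEMeasurable g volume)
    (hC1 : ∀ t : ℝ, t < 0 → g t = 0)
    (hC2 : ∃ C c : ℝ, 0 < C ∧ 0 < c ∧ ∀ t : ℝ, |g t| ≤ C * Real.exp (-c * t)) :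
    (∃ M : ℝ → Ω → ℝ, IsLinFracStableMotion P α d L M) ∧
    (∃ Y : ℝ → Ω → ℝ, IsFIMA P α d L g Y) ∧
    ∀ M Y : ℝ → Ω → ℝ, IsLinFracStableMotion P α d L M → IsFIMA P α d L g Y →
      ∀ t : ℝ,
        HasLFSMIntegral P α p d L M ((Set.Iic t).indicator fun x => g (t - x)) (Y t) ∧
        Y t =ᵐ[P] lfsmIntegral P α p d L M ((Set.Iic t).indicator fun x => g (t - x)) := by
  obtain ⟨C, c, hC, hc, hb⟩ := hC2
  have hgi : Integrable g volume := integrable_of_exp_bound hg hC1 hc hb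
  have hgB : ∀ s, |g s| ≤ C := by
    intro s
    rcases lt_or_ge s 0 with hs | hs
    · rw [hC1 s hs, abs_zero]; exact hC.le
    · refine (hb s).trans (mul_le_of_le_one_right hC.le (Real.exp_le_one_iff.2 ?_))
      rw [neg_mul]
      exact neg_nonpos.2 (mul_nonneg hc.le hs)
  have hh1 : ∀ t, MemLp (fun x => g (t - x)) 1 volume := fun t =>
    memLp_one_iff_integrable.2 (hgi.comp_sub_left t)
  have hhB : ∀ t x, |g (t - x)| ≤ C := fun t x => hgB _
  refine ⟨?_, ?_, fun M Y hM hY t => ?_⟩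
  · choose M hM using fun t => hL.exists_isStableLimit hp.le hpα (memLp_lfsmKernel hα.le hd hdα t)
    exact ⟨M, fun t => (hM t).hasStableIntegral hL hp.le hpα⟩
  · have hmem := fun t => memLp_fracIntegralRight hα.le hd hdα (hh1 t)
      (memLp_ofReal_of_bound hα.le (hh1 t) (hhB t))
    choose Y hY using fun t => hL.exists_isStableLimit hp.le hpα (hmem t)
    refine ⟨Y, fun t => ?_⟩
    rw [← fracIntegralRight_comp_sub hC1]
    exact (hY t).hasStableIntegral hL hp.le hpα
  · have hYt := (hY t).isStableLimit hL hp.le hpα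
    -- After reflection `Y t` is the stable integral of `I_-^d` of `x ↦ g (t - x)`; the cutoff at
    -- `t` is automatic since `g` vanishes on the negative axis.
    rw [← fracIntegralRight_comp_sub hC1] at hYt
    rw [indicator_Iic_comp_sub hC1]
    have hmain := hYt.hasLFSMIntegral hL hp.le hpα hd hdα hM (hh1 t) (hhB t)
    exact ⟨hmain, hmain.ae_eq_lfsmIntegral hp.le⟩
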